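/- Let $(x^1,x^2,x^3,y^1,y^2,y^3)$ be the standard coordinates of $\mathbb R^6$, let $\mathcal U\subset\mathbb R^6$ be open, and let $f$ be a smooth function on $\mathcal U$ with $f_3\neq 0$ on $\mathcal U$ that depends only on $(x^1,x^3)$, or only on $(x^2,x^3)$; subscripts denote partial derivatives with respect to the $x^i$. The rank-3 distribution annihilated by the 1-forms $\theta^1,\theta^2,\theta^3$ below is then generic, and Bryant's conformal class of this distribution is represented by the metric $g=g_{\mathcal D_f}=2\theta^1\theta^4+2\theta^2\theta^5+2\theta^3\theta^6$, where $2\alpha\beta=\alpha\otimes\beta+\beta\otimes\alpha$ and $$\theta^1=dy^1+x^2dx^3,\quad \theta^2=dy^2+f\,dx^1,\quad \theta^3=dy^3+x^1dx^2,\quad \theta^4=\tfrac32 f_3^2\,dx^1,\quad \theta^5=\tfrac32 f_3\,dx^2-\tfrac12 f_{33}\,\theta^1,$$ $$\theta^6=\tfrac32 f_3^2\,dx^3+\tfrac12 f_{13}\,\theta^2+\tfrac32 f_3f_2\,dx^2+\tfrac12(f_3f_{23}-f_2f_{33})\,\theta^1+\tfrac12(f_2f_{13}-f_3f_{12})\,\theta^3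 .$$ In dimension $n=6$ let $P=\frac1{n-2}\big(Ric-\frac{Scal}{2(n-1)}g\big)$ be the Schouten tensor of $g$, $W$ its Weyl tensor, $C_{ijk}=\nabla_kP_{ij}-\nabla_jP_{ik}$ its Cotton tensor and $B_{ij}=\nabla^kC_{ijk}-P^{kl}W_{kijl}$ its Bach tensor, with the sign conventions $W_{ijkl}=R_{ijkl}-(P_{ik}g_{jl}-P_{jk}g_{il}-P_{il}g_{jk}+P_{jl}g_{ik})$ and $Ric_{jl}=g^{ik}R_{ijkl}$, where $Ric$ is positive on round spheres. Call a metric conformally Cotton (conformally Einstein) on an open set $V$ if for some smooth $\varphi$ on $V$ the metric $e^{2\varphi}g$ has vanishing Cotton tensor (satisfies $Ric=\Lambda\, e^{2\varphi}g$ with a constant $\Lambda$) on $V$. Then: (i) Generically $[g_{\mathcal D_f}]$ is not conformally Cotton, hence not conformally Einstein. Precisely: for each of the two types of $f$ there is a nonzero real polynomial $\Phi$ in finitely many of the partial derivatives of a function of two variables such that, for all $\mathcal U$ and $f$ as above of that type and all $p\in\mathcal U$ where $\Phi$, evaluated on the partial derivatives of $f$ at $p$, is nonzero, $g_{\mathcal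 D_f}$ is neither conformally Cotton nor conformally Einstein on any open neighbourhood $V\subset\mathcal U$ of $p$. (ii) For every such $f$, on $\mathcal U$, $g_{\mathcal D_f}$ is a smooth semi-Riemannian metric, $B_{ij}=0$ and $P_i{}^kP_{kj}=0$; in particular $\mu_{ij}=\frac1{4-n}B_{ij}+P_i{}^kP_{kj}=0$. (iii) For every such $f$, each of the eight terms of the Fefferman–Graham obstruction tensor $$\mathcal O_{ij}=\nabla^k\nabla_kB_{ij}-2W_{kijl}B^{kl}-4P_k{}^kB_{ij}+8P^{kl}\nabla_lC_{(ij)k}-4C^k{}_i{}^lC_{ljk}+2C_i{}^{kl}C_{jkl}+4C_{ij}{}^l\nabla_lP_k{}^k-4W_{kijl}P^k{}_mP^{ml}$$ vanishes on $\mathcal U$, and hence $\mathcal O\equiv0$. (iv) For every such $f$ and every $\varepsilon>0$, the tensor $$\tilde g_f=2\,d(\varrho t)\,dt+t^2\big(g_{\mathcal D_f}+2\varrho P\big)$$ is an ambient metric for $g_{\mathcal D_f}$ on $(0,\infty)\times\mathcal U\times(-\varepsilon,\varepsilon)$ with coordinates $(t,x,\varrho)$. That is, it is a smooth semi-Riemannian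 metric of the form $2\,d(\varrho t)\,dt+t^2h(x,\varrho)$ with $h(x,0)=g_{\mathcal D_f}$, and $Ric(\tilde g_f)=0$. -/

import Mathlib

open scoped ContDiff

noncomputable section

namespace BryantConf

/-- Points of a coordinate domain in `ℝⁿ`. -/
abbrev Pt (n : ℕ) := Fin n → ℝ

/-- Two-tensors with both indices down, by their components in the coordinate frame. -/
abbrev Mat (n : ℕ) := Matrix (Fin n) (Fin n) ℝ

/-- The coordinate partial derivative `∂ᵢ φ`. -/
def pd {n : ℕ} (i : Fin n) (φ : Pt n → ℝ) : Pt n → ℝ :=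
  fun x => fderiv ℝ φ x (Pi.single i 1)

section Tensors

variable {n : ℕ}

/-- `g` is a smooth semi-Riemannian metric on the open set `U`. -/
def IsMetricOn (U : Set (Pt n)) (g : Pt n → Mat n) : Prop :=
  (∀ i j, ContDiffOn ℝ ∞ (fun x => g x i j) U) ∧
    ∀ x ∈ U, (g x).IsSymm ∧ (g x).det ≠ 0

/-- Christoffel symbols `Γᵏᵢⱼ` of the Levi-Civita connection of `g`. -/
def christoffel (g : Pt n → Mat n) (k i j : Fin n) (x : Pt n) : ℝ :=
  (1 / 2) * ∑ l, (g x)⁻¹ k l *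
    (pd i (fun y => g y j l) x + pd j (fun y => g y i l) x - pd l (fun y => g y i j) x)

/-- The curvature `Rᵏₗᵢⱼ`, where `(∇ᵢ∇ⱼ - ∇ⱼ∇ᵢ) Vᵏ = Rᵏₗᵢⱼ Vˡ`. -/
def riemannUp (g : Pt n → Mat n) (x : Pt n) (k l i j : Fin n) : ℝ :=
  pd i (christoffel g k j l) x - pd j (christoffel g k i l) x +
    ∑ m, (christoffel g k i m x * christoffel g m j l x -
      christoffel g k j m x * christoffel g m i l x)

/-- The curvature `Rᵢⱼₖₗ` with all indices down. -/
def riemann (g : Pt n → Mat n) (x : Pt n) (i j k l : Fin n) : ℝ :=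
  ∑ m, g x i m * riemannUp g x m j k l

/-- The Ricci tensor `Ricⱼₗ = Rᵏⱼₖₗ` (positive on round spheres). -/
def ricci (g : Pt n → Mat n) (x : Pt n) : Mat n :=
  Matrix.of fun j l => ∑ k, riemannUp g x k j k l

/-- The scalar curvature. -/
def scal (g : Pt n → Mat n) (x : Pt n) : ℝ :=
  ∑ i, ∑ j, (g x)⁻¹ i j * ricci g x i j

/-- The Schouten tensor `P = (Ric - Scal / (2 (n - 1)) g) / (n - 2)`. -/
def schouten (g : Pt n → Mat n) (x : Pt n) : Mat n :=
  (1 / ((n : ℝ) - 2)) • (ricci g x - (scal g x / (2 * ((n : ℝ) - 1))) • g x)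

/-- The Weyl tensor `Wᵢⱼₖₗ`. -/
def weyl (g : Pt n → Mat n) (x : Pt n) (i j k l : Fin n) : ℝ :=
  riemann g x i j k l -
    (schouten g x i k * g x j l - schouten g x j k * g x i l
      - schouten g x i l * g x j k + schouten g x j l * g x i k)

/-- The covariant derivative `∇ₖ Tᵢⱼ`. -/
def nabla2 (g : Pt n → Mat n) (T : Pt n → Mat n) (x : Pt n) (k i j : Fin n) : ℝ :=
  pd k (fun y => T y i j) x
    - ∑ m, christoffel g m k i x * T x m j
    - ∑ m, christoffel g m k j x * T x i m

/-- The covariant derivative `∇ₗ Tᵢⱼₖ`. -/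
def nabla3 (g : Pt n → Mat n) (T : Pt n → Fin n → Fin n → Fin n → ℝ) (x : Pt n)
    (l i j k : Fin n) : ℝ :=
  pd l (fun y => T y i j k) x
    - ∑ m, christoffel g m l i x * T x m j k
    - ∑ m, christoffel g m l j x * T x i m k
    - ∑ m, christoffel g m l k x * T x i j m

/-- The Cotton tensor `Cᵢⱼₖ = ∇ₖ Pᵢⱼ - ∇ⱼ Pᵢₖ`. -/
def cotton (g : Pt n → Mat n) (x : Pt n) (i j k : Fin n) : ℝ :=
  nabla2 g (schouten g) x k i j - nabla2 g (schouten g) x j i k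

/-- Raising the first index: `Tᵏⱼ`. -/
def raiseFst (g : Pt n → Mat n) (T : Pt n → Mat n) (x : Pt n) (k j : Fin n) : ℝ :=
  ∑ a, (g x)⁻¹ k a * T x a j

/-- Raising both indices: `Tᵏˡ`. -/
def raiseBoth (g : Pt n → Mat n) (T : Pt n → Mat n) (x : Pt n) (k l : Fin n) : ℝ :=
  ∑ a, ∑ b, (g x)⁻¹ k a * (g x)⁻¹ l b * T x a b

/-- The trace `Pₖᵏ` of the Schouten tensor. -/
def trSchouten (g : Pt n → Mat n) (x : Pt n) : ℝ :=
  ∑ k, raiseFst g (schouten g) x k k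

/-- The square `Pᵢᵏ Pₖⱼ` of the Schouten tensor. -/
def schoutenSq (g : Pt n → Mat n) (x : Pt n) : Mat n :=
  Matrix.of fun i j => ∑ k, ∑ l, schouten g x i l * (g x)⁻¹ l k * schouten g x k j

/-- The Bach tensor `Bᵢⱼ = ∇ᵏ Cᵢⱼₖ - Pᵏˡ Wₖᵢⱼₗ`. -/
def bach (g : Pt n → Mat n) (x : Pt n) : Mat n :=
  Matrix.of fun i j =>
    (∑ k, ∑ l, (g x)⁻¹ k l * nabla3 g (cotton g) x l i j k)
      - ∑ k, ∑ l, raiseBoth g (schouten g) x k l * weyl g x k i j l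

/-- The tensor `μᵢⱼ = Bᵢⱼ / (4 - n) + Pᵢᵏ Pₖⱼ`. -/
def mu (g : Pt n → Mat n) (x : Pt n) : Mat n :=
  (1 / (4 - (n : ℝ))) • bach g x + schoutenSq g x

/-- `∇ᵏ ∇ₖ Bᵢⱼ`. -/
def obsTerm₁ (g : Pt n → Mat n) (x : Pt n) : Mat n :=
  Matrix.of fun i j => ∑ k, ∑ l, (g x)⁻¹ k l * nabla3 g (nabla2 g (bach g)) x l k i j

/-- `-2 Wₖᵢⱼₗ Bᵏˡ`. -/
def obsTerm₂ (g : Pt n → Mat n) (x : Pt n) : Mat n :=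
  Matrix.of fun i j => -2 * ∑ k, ∑ l, weyl g x k i j l * raiseBoth g (bach g) x k l

/-- `-4 Pₖᵏ Bᵢⱼ`. -/
def obsTerm₃ (g : Pt n → Mat n) (x : Pt n) : Mat n :=
  Matrix.of fun i j => -4 * trSchouten g x * bach g x i j

/-- `8 Pᵏˡ ∇ₗ C₍ᵢⱼ₎ₖ`. -/
def obsTerm₄ (g : Pt n → Mat n) (x : Pt n) : Mat n :=
  Matrix.of fun i j => 8 * ∑ k, ∑ l, raiseBoth g (schouten g) x k l *
    ((1 / 2) * (nabla3 g (cotton g) x l i j k + nabla3 g (cotton g) x l j i k))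

/-- `-4 Cᵏᵢˡ Cₗⱼₖ`. -/
def obsTerm₅ (g : Pt n → Mat n) (x : Pt n) : Mat n :=
  Matrix.of fun i j => -4 * ∑ k, ∑ l,
    (∑ a, ∑ b, (g x)⁻¹ k a * (g x)⁻¹ l b * cotton g x a i b) * cotton g x l j k

/-- `2 Cᵢᵏˡ Cⱼₖₗ`. -/
def obsTerm₆ (g : Pt n → Mat n) (x : Pt n) : Mat n :=
  Matrix.of fun i j => 2 * ∑ k, ∑ l,
    (∑ a, ∑ b, (g x)⁻¹ k a * (g x)⁻¹ l b * cotton g x i a b) * cotton g x j k l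

/-- `4 Cᵢⱼˡ ∇ₗ Pₖᵏ`. -/
def obsTerm₇ (g : Pt n → Mat n) (x : Pt n) : Mat n :=
  Matrix.of fun i j => 4 * ∑ l,
    (∑ a, (g x)⁻¹ l a * cotton g x i j a) * pd l (trSchouten g) x

/-- `-4 Wₖᵢⱼₗ Pᵏₘ Pᵐˡ`. -/
def obsTerm₈ (g : Pt n → Mat n) (x : Pt n) : Mat n :=
  Matrix.of fun i j => -4 * ∑ k, ∑ l, ∑ m,
    weyl g x k i j l * raiseFst g (schouten g) x k m * raiseBoth g (schouten g) x m l

/-- The Fefferman–Graham obstruction tensor of a metric in dimension `6`. -/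
def obstruction (g : Pt 6 → Mat 6) (x : Pt 6) : Mat 6 :=
  obsTerm₁ g x + obsTerm₂ g x + obsTerm₃ g x + obsTerm₄ g x +
    obsTerm₅ g x + obsTerm₆ g x + obsTerm₇ g x + obsTerm₈ g x

/-- The conformally rescaled metric `e^{2φ} g`. -/
def rescale (φ : Pt n → ℝ) (g : Pt n → Mat n) : Pt n → Mat n :=
  fun x => Real.exp (2 * φ x) • g x

/-- Some metric in the conformal class of `g` on `V` has vanishing Cotton tensor. -/
def ConformallyCotton (V : Set (Pt n)) (g : Pt n → Mat n) : Prop :=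
  ∃ φ : Pt n → ℝ, ContDiffOn ℝ ∞ φ V ∧
    ∀ x ∈ V, ∀ i j k, cotton (rescale φ g) x i j k = 0

/-- Some metric in the conformal class of `g` on `V` is Einstein. -/
def ConformallyEinstein (V : Set (Pt n)) (g : Pt n → Mat n) : Prop :=
  ∃ φ : Pt n → ℝ, ContDiffOn ℝ ∞ φ V ∧
    ∃ Λ : ℝ, ∀ x ∈ V, ricci (rescale φ g) x = Λ • rescale φ g x

/-- The symmetric two-tensor `2 α β = α ⊗ β + β ⊗ α` of two covectors. -/
def symProd (α β : Fin n → ℝ) : Mat n :=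
  Matrix.of fun i j => α i * β j + β i * α j

/-- The coordinate covector `dxⁱ`. -/
def dx (i : Fin n) : Fin n → ℝ := Pi.single i 1

end Tensors

section Ambient

variable {n : ℕ}

/-- On the ambient space the coordinates are `(t, x¹, …, xⁿ, ϱ)`: index `0` is `t`, the last
index is `ϱ`, and this is the index of `xⁱ`. -/
def baseIdx (i : Fin n) : Fin (n + 2) := i.succ.castSucc

/-- The base point `x` of the ambient point `(t, x, ϱ)`. -/
def basePt (X : Pt (n + 2)) : Pt n := fun i => X (baseIdx i)

/-- The ambient space `(0, ∞) × U × (-ε, ε)`. -/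
def ambientSpace (U : Set (Pt n)) (ε : ℝ) : Set (Pt (n + 2)) :=
  {X | 0 < X 0 ∧ basePt X ∈ U ∧ |X (Fin.last (n + 1))| < ε}

/-- The tensor `2 d(ϱ t) dt + t² h(x, ϱ)`, where `d(ϱ t) = ϱ dt + t dϱ` and
`h(x, ϱ) = hᵢⱼ(x, ϱ) dxⁱ dxʲ`. -/
def ambientForm (h : Pt n → ℝ → Mat n) (X : Pt (n + 2)) : Mat (n + 2) :=
  symProd (X (Fin.last (n + 1)) • dx 0 + X 0 • dx (Fin.last (n + 1))) (dx 0) +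
    X 0 ^ 2 • Matrix.of fun a b =>
      ∑ i, ∑ j, h (basePt X) (X (Fin.last (n + 1))) i j * dx (baseIdx i) a * dx (baseIdx j) b

/-- `G` is an ambient metric for `g₀` on `(0, ∞) × U × (-ε, ε)`: a smooth semi-Riemannian metric
of the form `2 d(ϱ t) dt + t² h(x, ϱ)` with `h(x, 0) = g₀(x)`, and Ricci-flat. -/
def IsAmbientMetric (U : Set (Pt n)) (g₀ : Pt n → Mat n) (ε : ℝ)
    (G : Pt (n + 2) → Mat (n + 2)) : Prop :=
  IsMetricOn (ambientSpace U ε) G ∧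
    (∃ h : Pt n → ℝ → Mat n,
      (∀ X ∈ ambientSpace U ε, G X = ambientForm h X) ∧ ∀ x ∈ U, h x 0 = g₀ x) ∧
    ∀ X ∈ ambientSpace U ε, ricci G X = 0

end Ambient

section Bryant

/-! The coordinates `(x¹, x², x³, y¹, y², y³)` of `ℝ⁶` have the indices `0, 1, 2, 3, 4, 5`. -/

/-- `θ¹ = dy¹ + x² dx³`. -/
def θ₁ (x : Pt 6) : Fin 6 → ℝ := dx 3 + x 1 • dx 2

/-- `θ² = dy² + f dx¹`. -/
def θ₂ (f : Pt 6 → ℝ) (x : Pt 6) : Fin 6 → ℝ := dx 4 + f x • dx 0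

/-- `θ³ = dy³ + x¹ dx²`. -/
def θ₃ (x : Pt 6) : Fin 6 → ℝ := dx 5 + x 0 • dx 1

/-- `θ⁴ = (3/2) f₃² dx¹`. -/
def θ₄ (f : Pt 6 → ℝ) (x : Pt 6) : Fin 6 → ℝ := ((3 / 2) * pd 2 f x ^ 2) • dx 0

/-- `θ⁵ = (3/2) f₃ dx² - (1/2) f₃₃ θ¹`. -/
def θ₅ (f : Pt 6 → ℝ) (x : Pt 6) : Fin 6 → ℝ :=
  ((3 / 2) * pd 2 f x) • dx 1 - ((1 / 2) * pd 2 (pd 2 f) x) • θ₁ x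

/-- `θ⁶ = (3/2) f₃² dx³ + (1/2) f₁₃ θ² + (3/2) f₃ f₂ dx² + (1/2) (f₃ f₂₃ - f₂ f₃₃) θ¹
+ (1/2) (f₂ f₁₃ - f₃ f₁₂) θ³`. -/
def θ₆ (f : Pt 6 → ℝ) (x : Pt 6) : Fin 6 → ℝ :=
  ((3 / 2) * pd 2 f x ^ 2) • dx 2 + ((1 / 2) * pd 0 (pd 2 f) x) • θ₂ f x
    + ((3 / 2) * pd 2 f x * pd 1 f x) • dx 1
    + ((1 / 2) * (pd 2 f x * pd 1 (pd 2 f) x - pd 1 f x * pd 2 (pd 2 f) x)) • θ₁ x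
    + ((1 / 2) * (pd 1 f x * pd 0 (pd 2 f) x - pd 2 f x * pd 0 (pd 1 f) x)) • θ₃ x

/-- The metric `2 θ¹ θ⁴ + 2 θ² θ⁵ + 2 θ³ θ⁶`, which represents Bryant's conformal class of the
rank-3 distribution annihilated by `θ¹, θ², θ³`. -/
def bryantMetric (f : Pt 6 → ℝ) (x : Pt 6) : Mat 6 :=
  symProd (θ₁ x) (θ₄ f x) + symProd (θ₂ f x) (θ₅ f x) + symProd (θ₃ x) (θ₆ f x)

/-- `U` is open, `f` is smooth on `U`, `f` is a function of the two coordinates with indices `a`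
and `2` only, and `f₃ ≠ 0` on `U`. -/
def Admissible (a : Fin 6) (U : Set (Pt 6)) (f : Pt 6 → ℝ) : Prop :=
  IsOpen U ∧ ContDiffOn ℝ ∞ f U ∧
    (∀ x ∈ U, ∀ y ∈ U, x a = y a → x 2 = y 2 → f x = f y) ∧
    ∀ x ∈ U, pd 2 f x ≠ 0

/-- The jet coordinates at `p` of a function of the coordinates with indices `a` and `2`: the
pair `(r, s)` gives the value at `p` of the partial derivative of order `r` in the former and of
order `s` in the latter. -/
def jet (a : Fin 6) (f : Pt 6 → ℝ) (p : Pt 6) (m : ℕ × ℕ) : ℝ :=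
  ((pd a)^[m.1] ((pd 2)^[m.2] f)) p

end Bryant

end BryantConf

end

open scoped ContDiff

namespace BryantConf

/-! Since `f` depends on two coordinates only, every tensor in the theorem has components that are
rational functions of finitely many quantities, here called generators: a few coordinates, the
partial derivatives of `f` up to order six (the metric uses order two and the Bach tensor takes four
more derivatives), `t` and `ϱ` on the ambient space, and, for a rescaled metric, `exp (2 φ)` with
the partial derivatives of `φ` up to order three. The denominators are integers times monomials in
`f₃`, `t` and `exp (2 φ)`, none of which vanishes. Coordinate derivatives act on the generators by
fixed polynomial rules. The tensor calculus can therefore be carried out on formal fractions, and a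
tensor vanishes as soon as its formal numerators cancel. The proof consists of this algebra, its
soundness (`Rep`, `Rep.pd`, `RepMetric`) and a finite number of evaluations by the kernel
(`base_one`, `ambient_one`, `conformal_one` and their counterparts for the second type of `f`).
Soundness needs one direction only: an empty numerator forces the value zero. Nothing is claimed
about normal forms.

Part (i). Under `g ↦ e^{2φ} g` the Cotton tensor changes only by a contraction of the Weyl tensor
with `dφ`. For each type of `f` there is a component in which this contraction drops out: its value
is a fixed nonzero polynomial in the jet of `f`, divided by `108 f₃ᵐ`, whatever `φ` is. Where that
polynomial is nonzero, no rescaling has vanishing Cotton tensor (`not_conformallyCotton`). An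
Einstein metric has Schouten tensor a constant multiple of the metric, hence vanishing Cotton tensor
(`cotton_eq_zero_of_einstein`), which settles the Einstein case.

Parts (ii) and (iii). The evaluations give `B = 0`, `P² = 0`, `tr P = 0`, `Pᵏˡ ∇ₗ Cᵢⱼₖ = 0` and the
vanishing of the two quadratic contractions of the Cotton tensor. Each of the eight terms of the
obstruction tensor contains one of these factors or a derivative of one.

Part (iv). As `μ` is the coefficient of `ϱ²` in the Fefferman–Graham expansion, its vanishing
suggests that the expansion stops after `g + 2ϱP`. Ricci-flatness of the resulting metric is
verified directly. Because `P² = 0`, the inverse of `g + 2ϱP` is `g⁻¹ - 2ϱP` with the indices of `P`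
raised, so the ambient metric has an explicit inverse as well. -/

/-! ### Polynomials with integer coefficients, in a form that the kernel evaluates fast

A monomial in generators that are indexed by prime numbers is coded by the product of these primes,
a polynomial by the list of its terms, ordered by the codes of the monomials. -/

/-- The value of the monomial with code `m` when the generator `p` has the value `ρ p`. -/
noncomputable def mval (ρ : ℕ → ℝ) (m : ℕ) : ℝ :=
  if m = 0 then 0 else (m.primeFactorsList.map ρ).prod

@[simp] theorem mval_zero (ρ : ℕ → ℝ) : mval ρ 0 = 0 := by simp [mval]

@[simp] theorem mval_one (ρ : ℕ → ℝ) : mval ρ 1 = 1 := by simp [mval]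

/-- Unique factorisation. The convention that the code `0` has the value `0` makes the rule hold
without exceptions. -/
theorem mval_mul (ρ : ℕ → ℝ) (m k : ℕ) : mval ρ (m * k) = mval ρ m * mval ρ k := by
  rcases eq_or_ne m 0 with rfl | hm
  · simp
  rcases eq_or_ne k 0 with rfl | hk
  · simp
  have h := ((Nat.perm_primeFactorsList_mul hm hk).map ρ).prod_eq
  simp [mval, hm, hk, h]

theorem mval_prime (ρ : ℕ → ℝ) {p : ℕ} (hp : p.Prime) : mval ρ p = ρ p := by
  simp [mval, hp.ne_zero, Nat.primeFactorsList_prime hp]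

theorem mval_ne_zero_of_dvd {ρ : ℕ → ℝ} {m k : ℕ} (h : m ∣ k) (hk : mval ρ k ≠ 0) :
    mval ρ m ≠ 0 := by
  obtain ⟨l, rfl⟩ := h
  rw [mval_mul] at hk
  exact left_ne_zero_of_mul hk

theorem mval_pow (ρ : ℕ → ℝ) (m k : ℕ) : mval ρ (m ^ k) = mval ρ m ^ k := by
  induction k with
  | zero => simp
  | succ k ih => rw [pow_succ, pow_succ, mval_mul, ih]

theorem mval_lcm_ne_zero {ρ : ℕ → ℝ} {m k : ℕ} (hm : mval ρ m ≠ 0) (hk : mval ρ k ≠ 0) :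
    mval ρ (m.lcm k) ≠ 0 := by
  refine mval_ne_zero_of_dvd (Nat.lcm_dvd_mul m k) ?_
  rw [mval_mul]
  exact mul_ne_zero hm hk

/-- A polynomial, as the list of its terms: codes of monomials with coefficients. -/
abbrev Poly := List (ℕ × ℤ)

namespace Poly

/-- The value of a polynomial. -/
noncomputable def val (ρ : ℕ → ℝ) (p : Poly) : ℝ :=
  (p.map fun t => (t.2 : ℝ) * mval ρ t.1).sum

@[simp] theorem val_nil (ρ : ℕ → ℝ) : val ρ [] = 0 := rfl

@[simp] theorem val_cons (ρ : ℕ → ℝ) (t : ℕ × ℤ) (p : Poly) :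
    val ρ (t :: p) = t.2 * mval ρ t.1 + val ρ p := by
  simp [val]

/-- Put a term in front of a polynomial, unless its coefficient is zero. -/
def consTerm (m : ℕ) (c : ℤ) (p : Poly) : Poly :=
  match c with
  | Int.ofNat n => bif Nat.beq n 0 then p else (m, Int.ofNat n) :: p
  | Int.negSucc n => (m, Int.negSucc n) :: p

theorem val_consTerm (ρ : ℕ → ℝ) (m : ℕ) (c : ℤ) (p : Poly) :
    val ρ (consTerm m c p) = c * mval ρ m + val ρ p := by
  unfold consTerm
  split
  · rename_i n
    cases n with
    | zero => simp
    | succ n =>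
      have e : Nat.beq (n + 1) 0 = false := rfl
      simp [e]
  · simp

/-- The sum of `t :: tail` and `q`, where `rest` adds `tail`. -/
noncomputable def merge (t : ℕ × ℤ) (tail : Poly) (rest : Poly → Poly) (q : Poly) : Poly :=
  List.rec (t :: tail)
    (fun u q ih =>
      bif Nat.beq t.1 u.1 then consTerm t.1 (Int.add t.2 u.2) (rest q)
      else bif Nat.ble t.1 u.1 then t :: rest (u :: q)
      else u :: ih) q

/-- The sum of two polynomials. -/
noncomputable def add (p : Poly) : Poly → Poly :=
  List.rec (fun q => q) (fun t p ih q => merge t p ih q) p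

theorem val_merge (ρ : ℕ → ℝ) (t : ℕ × ℤ) (tail : Poly) (rest : Poly → Poly)
    (h : ∀ q, val ρ (rest q) = val ρ tail + val ρ q) (q : Poly) :
    val ρ (merge t tail rest q) = val ρ (t :: tail) + val ρ q := by
  induction q with
  | nil => simp [merge]
  | cons u q ih =>
    have e : merge t tail rest (u :: q) =
        bif Nat.beq t.1 u.1 then consTerm t.1 (Int.add t.2 u.2) (rest q)
        else bif Nat.ble t.1 u.1 then t :: rest (u :: q)
        else u :: merge t tail rest q := rfl
    rw [e]
    cases h1 : Nat.beq t.1 u.1 with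
    | true =>
      have := Nat.eq_of_beq_eq_true h1
      have e2 : Int.add t.2 u.2 = t.2 + u.2 := rfl
      simp only [cond_true, val_consTerm, h, val_cons, e2, this, Int.cast_add]
      ring
    | false =>
      cases h2 : Nat.ble t.1 u.1 with
      | true => simp only [cond_true, cond_false, h, val_cons]; ring
      | false =>
        simp only [cond_false, val_cons, ih]
        ring

/-- No ordering of the terms is assumed: the order of the codes only decides whether like terms meet
and cancel, not whether the value is right. -/
theorem val_add (ρ : ℕ → ℝ) (p q : Poly) : val ρ (add p q) = val ρ p + val ρ q := by
  induction p generalizing q with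
  | nil => simp [add]
  | cons t p ih => exact val_merge ρ t p (add p) ih q

/-- The product of a polynomial with the monomial `m` and the number `c`. -/
noncomputable def scale (m : ℕ) (c : ℤ) (p : Poly) : Poly :=
  List.rec [] (fun t _ ih => (Nat.mul m t.1, Int.mul c t.2) :: ih) p

theorem val_scale (ρ : ℕ → ℝ) (m : ℕ) (c : ℤ) (p : Poly) :
    val ρ (scale m c p) = c * mval ρ m * val ρ p := by
  induction p with
  | nil => simp [scale]
  | cons t p ih =>
    have e : scale m c (t :: p) = (m * t.1, c * t.2) :: scale m c p := rfl
    rw [e, val_cons, val_cons, ih, mval_mul]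
    push_cast
    ring

/-- Add the polynomials in a list in pairs. -/
noncomputable def pairs (l : List Poly) : Option Poly → List Poly :=
  List.rec (fun o => Option.rec [] (fun q => [q]) o)
    (fun p _ ih o => Option.rec (ih (some p)) (fun q => add q p :: ih none) o) l

/-- The sum of a list of polynomials. -/
noncomputable def sumAux (fuel : ℕ) : List Poly → Poly :=
  Nat.rec (fun l => List.rec [] (fun p _ ih => add p ih) l)
    (fun _ ih l =>
      List.rec [] (fun p l' _ => List.rec p (fun _ _ _ => ih (pairs l none)) l') l) fuel

/-- The sum of a list of polynomials. -/
noncomputable def sum (l : List Poly) : Poly := sumAux 30 l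

/-- The optional argument is a summand that still waits for its partner. Adding in pairs keeps the
summands of comparable length. -/
theorem val_pairs (ρ : ℕ → ℝ) (l : List Poly) (o : Option Poly) :
    ((pairs l o).map (val ρ)).sum = (o.elim 0 (val ρ)) + (l.map (val ρ)).sum := by
  induction l generalizing o with
  | nil => cases o <;> simp [pairs]
  | cons p l ih =>
    cases o with
    | none =>
      have e : pairs (p :: l) none = pairs l (some p) := rfl
      rw [e, ih]
      simp
    | some q =>
      have e : pairs (p :: l) (some q) = add q p :: pairs l none := rfl
      rw [e, List.map_cons, List.sum_cons, ih, val_add]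
      simp [add_assoc]

theorem val_sum (ρ : ℕ → ℝ) (l : List Poly) : val ρ (sum l) = (l.map (val ρ)).sum := by
  -- The value does not depend on the fuel, since exhausted fuel only leads to summation one by one.
  have h : ∀ fuel l, val ρ (sumAux fuel l) = (l.map (val ρ)).sum := by
    intro fuel
    induction fuel with
    | zero =>
      intro l
      induction l with
      | nil => rfl
      | cons p l ih =>
        have e : sumAux 0 (p :: l) = add p (sumAux 0 l) := rfl
        rw [e, val_add, ih, List.map_cons, List.sum_cons]
    | succ k ih =>
      intro l
      match l with
      | [] => rfl
      | [p] => simp [sumAux]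
      | p :: q :: l =>
        have e : sumAux (k + 1) (p :: q :: l) = sumAux k (pairs (p :: q :: l) none) := rfl
        rw [e, ih, val_pairs]
        simp
  exact h 30 l

/-- The product of two polynomials. -/
noncomputable def mul (p q : Poly) : Poly :=
  sum (List.rec [] (fun t _ ih => scale t.1 t.2 q :: ih) p)

theorem val_mul (ρ : ℕ → ℝ) (p q : Poly) : val ρ (mul p q) = val ρ p * val ρ q := by
  rw [mul, val_sum]
  induction p with
  | nil => simp
  | cons t p ih => rw [List.map_cons, List.sum_cons, ih, val_scale, val_cons]; ring

/-- The exponent of the generator `p` in the monomial `m`, if it is at most `fuel`. -/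
noncomputable def mult (p : ℕ) (fuel : ℕ) (m : ℕ) : ℕ :=
  Nat.rec (fun _ => 0)
    (fun _ ih m => bif Nat.beq (Nat.mod m p) 0 then Nat.succ (ih (Nat.div m p)) else 0) fuel m

theorem mult_eq {p : ℕ} (hp : p.Prime) (fuel m : ℕ) (hm : m ≠ 0) (h : m.factorization p ≤ fuel) :
    mult p fuel m = m.factorization p := by
  induction fuel generalizing m with
  | zero => rw [Nat.le_zero.mp h]; rfl
  | succ k ih =>
    have e : mult p (k + 1) m =
        bif Nat.beq (m % p) 0 then Nat.succ (mult p k (m / p)) else 0 := rfl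
    rw [e]
    cases h1 : Nat.beq (m % p) 0 with
    | true =>
      obtain ⟨l, rfl⟩ := Nat.dvd_of_mod_eq_zero (Nat.eq_of_beq_eq_true h1)
      have hl : l ≠ 0 := right_ne_zero_of_mul hm
      have hf : (p * l).factorization p = l.factorization p + 1 := by
        rw [Nat.factorization_mul hp.ne_zero hl, Finsupp.add_apply, hp.factorization_self, add_comm]
      rw [hf] at h ⊢
      rw [Nat.mul_div_cancel_left _ hp.pos, ih l hl (by omega)]
      rfl
    | false =>
      have : ¬ p ∣ m := fun hd => by
        rw [Nat.mod_eq_zero_of_dvd hd] at h1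
        exact absurd h1 (by decide)
      rw [Nat.factorization_eq_zero_of_not_dvd this]
      rfl

/-- The derivative of the term `c m`, where `dl` lists generators with their derivatives. -/
noncomputable def derivGroup (dl : List (ℕ × Poly)) (m : ℕ) (c : ℤ) : Poly :=
  List.rec [] (fun d _ ih =>
    bif Nat.beq (Nat.mod m d.1) 0 then
      add (scale (Nat.div m d.1) (Int.mul c (Int.ofNat (mult d.1 (Nat.log2 m) m))) d.2) ih
    else ih) dl

/-- The product of the generators in the list `dl`. -/
noncomputable def keyProd (dl : List (ℕ × Poly)) : ℕ :=
  List.rec 1 (fun d _ ih => Nat.mul d.1 ih) dl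

/-- The derivative of the term `c m`, where `gl` lists groups of generators with their
derivatives. -/
noncomputable def derivTerm (gl : List (List (ℕ × Poly))) (m : ℕ) (c : ℤ) : Poly :=
  List.rec [] (fun dl _ ih =>
    bif Nat.beq (Nat.gcd m (keyProd dl)) 1 then ih else add (derivGroup dl m c) ih) gl

/-- The derivative of a polynomial. -/
noncomputable def deriv (gl : List (List (ℕ × Poly))) (p : Poly) : Poly :=
  sum (List.rec [] (fun t _ ih => derivTerm gl t.1 t.2 :: ih) p)

theorem val_deriv (ρ : ℕ → ℝ) (gl : List (List (ℕ × Poly))) (p : Poly) :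
    val ρ (deriv gl p) = (p.map fun t => val ρ (derivTerm gl t.1 t.2)).sum := by
  rw [deriv, val_sum]
  congr 1
  induction p with
  | nil => rfl
  | cons t p ih => rw [List.map_cons, List.map_cons, ih]

theorem val_derivGroup (ρ : ℕ → ℝ) (dl : List (ℕ × Poly)) (hdl : ∀ d ∈ dl, d.1.Prime) (m : ℕ)
    (c : ℤ) : val ρ (derivGroup dl m c) =
      c * (dl.map fun d => (m.factorization d.1 : ℝ) * mval ρ (m / d.1) * val ρ d.2).sum := by
  induction dl with
  | nil => simp [derivGroup]
  | cons d dl ih =>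
    have e : derivGroup (d :: dl) m c =
        bif Nat.beq (m % d.1) 0 then
          add (scale (m / d.1) (c * (mult d.1 (Nat.log2 m) m : ℕ)) d.2) (derivGroup dl m c)
        else derivGroup dl m c := rfl
    have ih := ih fun d' hd' => hdl d' (List.mem_cons_of_mem _ hd')
    have hp := hdl d List.mem_cons_self
    rw [e, List.map_cons, List.sum_cons]
    cases h1 : Nat.beq (m % d.1) 0 with
    | true =>
      rcases eq_or_ne m 0 with rfl | hm
      · simp [val_add, val_scale, ih]
      -- The fuel `Nat.log2 m` suffices: if `e` is the exponent of the prime `p` in `m`, then `2 ^ e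
      -- ≤ p ^ e ≤ m`.
      have hf : m.factorization d.1 ≤ Nat.log2 m := by
        rw [Nat.log2_eq_log_two]
        refine Nat.le_log_of_pow_le one_lt_two ?_
        calc 2 ^ m.factorization d.1 ≤ d.1 ^ m.factorization d.1 :=
              Nat.pow_le_pow_left hp.two_le _
          _ ≤ m := Nat.le_of_dvd (Nat.pos_of_ne_zero hm) (Nat.ordProj_dvd m d.1)
      rw [cond_true, val_add, val_scale, ih, mult_eq hp _ _ hm hf]
      push_cast
      ring
    | false =>
      have : ¬ d.1 ∣ m := fun hd => by
        rw [Nat.mod_eq_zero_of_dvd hd] at h1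
        exact absurd h1 (by decide)
      rw [cond_false, ih, Nat.factorization_eq_zero_of_not_dvd this]
      simp

theorem dvd_keyProd {dl : List (ℕ × Poly)} {d : ℕ × Poly} (hd : d ∈ dl) : d.1 ∣ keyProd dl := by
  induction dl with
  | nil => exact absurd hd List.not_mem_nil
  | cons d' dl ih =>
    rcases List.mem_cons.mp hd with rfl | hd
    · exact Dvd.intro _ rfl
    · exact Dvd.dvd.mul_left (ih hd) d'.1

/-- The Leibniz rule for a monomial: each generator contributes its exponent, the monomial with one
factor removed, and its derivative. Grouping the generators allows one gcd to discard a whole group.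
-/
theorem val_derivTerm (ρ : ℕ → ℝ) (gl : List (List (ℕ × Poly)))
    (hgl : ∀ d ∈ gl.flatten, d.1.Prime) (m : ℕ) (c : ℤ) : val ρ (derivTerm gl m c) =
      c * (gl.flatten.map fun d =>
        (m.factorization d.1 : ℝ) * mval ρ (m / d.1) * val ρ d.2).sum := by
  induction gl with
  | nil => simp [derivTerm]
  | cons dl gl ih =>
    have e : derivTerm (dl :: gl) m c =
        bif Nat.beq (Nat.gcd m (keyProd dl)) 1 then derivTerm gl m c
        else add (derivGroup dl m c) (derivTerm gl m c) := rfl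
    rw [List.flatten_cons] at hgl ⊢
    have ih := ih fun d hd => hgl d (List.mem_append_right _ hd)
    have hdl : ∀ d ∈ dl, d.1.Prime := fun d hd => hgl d (List.mem_append_left _ hd)
    rw [e, List.map_append, List.sum_append]
    cases h : Nat.beq (Nat.gcd m (keyProd dl)) 1 with
    | true =>
      have hz : (dl.map fun d =>
          (m.factorization d.1 : ℝ) * mval ρ (m / d.1) * val ρ d.2).sum = 0 := by
        refine List.sum_eq_zero fun z hz => ?_
        obtain ⟨d, hd, rfl⟩ := List.mem_map.mp hz
        have hn : ¬ d.1 ∣ m := fun hm => (hdl d hd).one_lt.ne'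
          (Nat.dvd_one.mp (Nat.eq_of_beq_eq_true h ▸ Nat.dvd_gcd hm (dvd_keyProd hd)))
        rw [Nat.factorization_eq_zero_of_not_dvd hn]
        simp
      rw [cond_true, ih, hz, zero_add]
    | false =>
      rw [cond_false, val_add, val_derivGroup ρ dl hdl, ih, mul_add]

end Poly

/-! ### Quotients of polynomials by monomials -/

/-- The quotient of the polynomial `p` by the number `c` and the monomial `d`. -/
structure Frac where
  c : ℕ
  d : ℕ
  p : Poly

namespace Frac

/-- The denominator. -/
noncomputable def den (ρ : ℕ → ℝ) (F : Frac) : ℝ := F.c * mval ρ F.d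

/-- `F` represents the number `v`. -/
def Val (ρ : ℕ → ℝ) (v : ℝ) (F : Frac) : Prop :=
  F.den ρ ≠ 0 ∧ v * F.den ρ = F.p.val ρ

/-- The zero fraction. -/
def zero : Frac := ⟨1, 1, []⟩

/-- An integer. -/
def int (z : ℤ) : Frac := ⟨1, 1, Poly.consTerm 1 z []⟩

/-- The monomial `m`. -/
def gen (m : ℕ) : Frac := ⟨1, 1, [(m, 1)]⟩

/-- The inverse of the number `c` times the monomial `m`. -/
def inv (c m : ℕ) : Frac := ⟨c, m, [(1, 1)]⟩

/-- The sum of two fractions with non-zero numerators. -/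
noncomputable def addAux (c d : ℕ) (p : Poly) (c' d' : ℕ) (p' : Poly) : Frac :=
  bif Nat.beq c c' && Nat.beq d d' then ⟨c, d, Poly.add p p'⟩
  else ⟨Nat.lcm c c', Nat.lcm d d',
    Poly.add (Poly.scale (Nat.div (Nat.lcm d d') d) (Int.ofNat (Nat.div (Nat.lcm c c') c)) p)
      (Poly.scale (Nat.div (Nat.lcm d d') d') (Int.ofNat (Nat.div (Nat.lcm c c') c')) p')⟩

/-- The sum of two fractions. -/
noncomputable def add (F G : Frac) : Frac :=
  match F with
  | ⟨c, d, p⟩ =>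
    match p with
    | [] => G
    | t :: p =>
      match G with
      | ⟨c', d', q⟩ =>
        match q with
        | [] => ⟨c, d, t :: p⟩
        | u :: q => addAux c d (t :: p) c' d' (u :: q)

/-- The negative of a fraction. -/
noncomputable def neg (F : Frac) : Frac := ⟨F.c, F.d, Poly.scale 1 (-1) F.p⟩

/-- The difference of two fractions. -/
noncomputable def sub (F G : Frac) : Frac := add F (neg G)

/-- The product of two fractions. -/
noncomputable def mul (F G : Frac) : Frac :=
  match F with
  | ⟨c, d, p⟩ =>
    match p with
    | [] => zero
    | t :: p =>
      match G with
      | ⟨c', d', q⟩ =>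
        match q with
        | [] => zero
        | u :: q => ⟨Nat.mul c c', Nat.mul d d', Poly.mul (t :: p) (u :: q)⟩

/-- `f 0 + ⋯ + f (n - 1)`. -/
noncomputable def sumTo (n : ℕ) (f : ℕ → Frac) : Frac :=
  Nat.rec zero (fun k ih => add ih (f k)) n

/-- The fraction has no terms. -/
def isZero (F : Frac) : Bool :=
  match F.p with
  | [] => true
  | _ :: _ => false

/-- The derivative of a fraction. -/
noncomputable def deriv (gl : List (List (ℕ × Poly))) (F : Frac) : Frac :=
  match F with
  | ⟨c, d, p⟩ =>
    match Poly.derivTerm gl d 1 with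
    | [] => ⟨c, d, Poly.deriv gl p⟩
    | u :: q =>
      ⟨c, Nat.mul d d, Poly.add (Poly.scale d 1 (Poly.deriv gl p))
        (Poly.scale 1 (-1) (Poly.mul (u :: q) p))⟩

/-- The greatest common divisor of `d` and the monomials of `p`. -/
noncomputable def content (d : ℕ) (p : Poly) : ℕ :=
  List.rec d (fun t _ ih => Nat.gcd t.1 ih) p

/-- Cancel the monomial `e`. -/
noncomputable def cancel (e : ℕ) (F : Frac) : Frac :=
  ⟨F.c, Nat.div F.d e, List.rec [] (fun t _ ih => (Nat.div t.1 e, t.2) :: ih) F.p⟩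

/-- Cancel the common monomial factors of numerator and denominator. -/
noncomputable def reduce (F : Frac) : Frac := cancel (content F.d F.p) F

variable {ρ : ℕ → ℝ} {F G : Frac} {v w : ℝ}

/-- All vanishing statements below come from this: the denominator is nonzero, so an empty numerator
forces the value zero. -/
theorem Val.eq_zero (h : Val ρ v F) (hF : F.isZero = true) : v = 0 := by
  obtain ⟨c, d, p⟩ := F
  cases p with
  | nil => exact (mul_eq_zero.mp h.2).resolve_right h.1
  | cons t p => exact absurd hF (by simp [isZero])

theorem val_zero : Val ρ 0 zero := by simp [Val, den, zero]

theorem val_int (z : ℤ) : Val ρ z (int z) := by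
  simp [Val, den, int, Poly.val_consTerm]

theorem val_gen (m : ℕ) : Val ρ (mval ρ m) (gen m) := by
  simp [Val, den, gen]

theorem val_inv_mval {c m : ℕ} (hc : c ≠ 0) (hm : mval ρ m ≠ 0) :
    Val ρ (1 / (c * mval ρ m)) (inv c m) := by
  have h : (c : ℝ) * mval ρ m ≠ 0 := mul_ne_zero (Nat.cast_ne_zero.mpr hc) hm
  refine ⟨h, ?_⟩
  simp only [den, inv, one_div, inv_mul_cancel₀ h]
  simp

theorem val_inv {c : ℕ} (hc : c ≠ 0) : Val ρ (1 / c) (inv c 1) := by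
  have := val_inv_mval (ρ := ρ) (m := 1) hc (by simp)
  simpa only [mval_one, mul_one] using this

theorem addAux_val {c d c' d' : ℕ} {p p' : Poly} (hF : Val ρ v ⟨c, d, p⟩)
    (hG : Val ρ w ⟨c', d', p'⟩) : Val ρ (v + w) (addAux c d p c' d' p') := by
  have hF1 := hF.1
  have hF2 := hF.2
  have hG1 := hG.1
  have hG2 := hG.2
  simp only [den] at hF1 hF2 hG1 hG2
  unfold addAux
  cases h : Nat.beq c c' && Nat.beq d d' with
  | true =>
    rw [Bool.and_eq_true] at h
    have h1 := Nat.eq_of_beq_eq_true h.1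
    have h2 := Nat.eq_of_beq_eq_true h.2
    subst h1 h2
    refine ⟨hF1, ?_⟩
    simp only [cond_true, den, Poly.val_add, ← hF2, ← hG2]
    ring
  | false =>
    have hc : ((Nat.lcm c c' : ℕ) : ℝ) = (Nat.lcm c c' / c : ℕ) * c := by
      rw [← Nat.cast_mul, Nat.div_mul_cancel (Nat.dvd_lcm_left c c')]
    have hc' : ((Nat.lcm c c' : ℕ) : ℝ) = (Nat.lcm c c' / c' : ℕ) * c' := by
      rw [← Nat.cast_mul, Nat.div_mul_cancel (Nat.dvd_lcm_right c c')]
    have hd : mval ρ (Nat.lcm d d') = mval ρ (Nat.lcm d d' / d) * mval ρ d := by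
      rw [← mval_mul, Nat.div_mul_cancel (Nat.dvd_lcm_left d d')]
    have hd' : mval ρ (Nat.lcm d d') = mval ρ (Nat.lcm d d' / d') * mval ρ d' := by
      rw [← mval_mul, Nat.div_mul_cancel (Nat.dvd_lcm_right d d')]
    refine ⟨?_, ?_⟩
    · simp only [cond_false, den]
      refine mul_ne_zero ?_ (mval_lcm_ne_zero (right_ne_zero_of_mul hF1)
        (right_ne_zero_of_mul hG1))
      exact Nat.cast_ne_zero.mpr (Nat.lcm_ne_zero
        (Nat.cast_ne_zero.mp (left_ne_zero_of_mul hF1))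
        (Nat.cast_ne_zero.mp (left_ne_zero_of_mul hG1)))
    · have e1 : ∀ k : ℕ, ((Int.ofNat k : ℤ) : ℝ) = k := fun k => by simp
      have e2 : ∀ k l : ℕ, Nat.div k l = k / l := fun _ _ => rfl
      simp only [cond_false, den, Poly.val_add, Poly.val_scale, e1, e2, ← hF2, ← hG2]
      rw [add_mul]
      congr 1
      · rw [hc, hd]; ring
      · rw [hc', hd']; ring

theorem Val.add (hF : Val ρ v F) (hG : Val ρ w G) : Val ρ (v + w) (add F G) := by
  obtain ⟨c, d, p⟩ := F
  obtain ⟨c', d', q⟩ := G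
  cases p with
  | nil =>
    have : v = 0 := hF.eq_zero rfl
    rw [this, zero_add]
    exact hG
  | cons t p =>
    cases q with
    | nil =>
      have : w = 0 := hG.eq_zero rfl
      rw [this, add_zero]
      exact hF
    | cons u q => exact addAux_val hF hG

theorem Val.neg (hF : Val ρ v F) : Val ρ (-v) F.neg := by
  refine ⟨hF.1, ?_⟩
  have h : F.neg.den ρ = F.den ρ := rfl
  rw [h, neg_mul, hF.2, Frac.neg, Poly.val_scale]
  simp

theorem Val.sub (hF : Val ρ v F) (hG : Val ρ w G) : Val ρ (v - w) (sub F G) := by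
  rw [sub_eq_add_neg]
  exact hF.add hG.neg

theorem Val.mul (hF : Val ρ v F) (hG : Val ρ w G) : Val ρ (v * w) (mul F G) := by
  obtain ⟨c, d, p⟩ := F
  obtain ⟨c', d', q⟩ := G
  cases p with
  | nil =>
    have : v = 0 := hF.eq_zero rfl
    rw [this, zero_mul]
    exact val_zero
  | cons t p =>
    cases q with
    | nil =>
      have : w = 0 := hG.eq_zero rfl
      rw [this, mul_zero]
      exact val_zero
    | cons u q =>
      have e : Frac.mul ⟨c, d, t :: p⟩ ⟨c', d', u :: q⟩ =
        ⟨c * c', d * d', Poly.mul (t :: p) (u :: q)⟩ := rfl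
      have ed : Frac.den ρ ⟨c * c', d * d', Poly.mul (t :: p) (u :: q)⟩ =
          Frac.den ρ ⟨c, d, t :: p⟩ * Frac.den ρ ⟨c', d', u :: q⟩ := by
        simp only [den, mval_mul]
        push_cast
        ring
      rw [e]
      refine ⟨?_, ?_⟩
      · rw [ed]
        exact mul_ne_zero hF.1 hG.1
      · rw [ed, Poly.val_mul, ← hF.2, ← hG.2]
        ring

theorem content_dvd (d : ℕ) (p : Poly) :
    content d p ∣ d ∧ ∀ t ∈ p, content d p ∣ t.1 := by
  induction p with
  | nil => exact ⟨dvd_rfl, by simp⟩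
  | cons t p ih =>
    have e : content d (t :: p) = Nat.gcd t.1 (content d p) := rfl
    rw [e]
    refine ⟨(Nat.gcd_dvd_right _ _).trans ih.1, fun u hu => ?_⟩
    rcases List.mem_cons.mp hu with rfl | hu
    · exact Nat.gcd_dvd_left _ _
    · exact (Nat.gcd_dvd_right _ _).trans (ih.2 u hu)

theorem Val.cancel {e : ℕ} (hF : Val ρ v F) (hd : e ∣ F.d) (hp : ∀ t ∈ F.p, e ∣ t.1) :
    Val ρ v (F.cancel e) := by
  obtain ⟨c, d, p⟩ := F
  obtain ⟨k, rfl⟩ : e ∣ d := hd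
  have h1 := hF.1
  have h2 := hF.2
  simp only [den, mval_mul] at h1 h2
  -- The cancelled monomial divides a denominator that does not vanish, so it may be divided out.
  have he : mval ρ e ≠ 0 := left_ne_zero_of_mul (right_ne_zero_of_mul h1)
  have hk : mval ρ k ≠ 0 := right_ne_zero_of_mul (right_ne_zero_of_mul h1)
  have e0 : e ≠ 0 := fun h => he (by rw [h, mval_zero])
  have hdiv : Nat.div (e * k) e = k := Nat.mul_div_cancel_left k (Nat.pos_of_ne_zero e0)
  have key : ∀ q : Poly, (∀ t ∈ q, e ∣ t.1) → mval ρ e * Poly.val ρ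
      (List.rec [] (fun t _ ih => (Nat.div t.1 e, t.2) :: ih) q) = Poly.val ρ q := by
    intro q hq
    induction q with
    | nil => simp
    | cons t q ih =>
      obtain ⟨m, hm⟩ := hq t List.mem_cons_self
      have hm' : Nat.div (e * m) e = m :=
        Nat.mul_div_cancel_left m (Nat.pos_of_ne_zero e0)
      have h3 := ih fun u hu => hq u (List.mem_cons_of_mem _ hu)
      simp only [Poly.val_cons, mul_add, h3, hm, hm', mval_mul]
      ring
  refine ⟨?_, mul_left_cancel₀ he ?_⟩
  · simp only [den, Frac.cancel, hdiv]
    exact mul_ne_zero (left_ne_zero_of_mul h1) hk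
  · simp only [den, Frac.cancel, hdiv, key p hp, ← h2]
    ring

theorem Val.reduce (hF : Val ρ v F) : Val ρ v F.reduce :=
  hF.cancel (content_dvd _ _).1 (content_dvd _ _).2

theorem val_sumTo (n : ℕ) (f : ℕ → Frac) (h : Fin n → ℝ) (hf : ∀ i : Fin n, Val ρ (h i) (f i)) :
    Val ρ (∑ i, h i) (sumTo n f) := by
  induction n with
  | zero =>
    rw [Fin.sum_univ_zero]
    exact val_zero
  | succ n ih =>
    rw [Fin.sum_univ_castSucc]
    exact (ih (fun i => h i.castSucc) fun i => hf i.castSucc).add (hf (Fin.last n))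

end Frac

/-! ### Coordinate derivatives -/

section PartialDerivatives

variable {n : ℕ} {U : Set (Pt n)} {φ ψ : Pt n → ℝ} {x : Pt n}

theorem differentiableAt_of_contDiffOn (hU : IsOpen U) (h : ContDiffOn ℝ ∞ φ U) (hx : x ∈ U) :
    DifferentiableAt ℝ φ x :=
  (h.contDiffAt (hU.mem_nhds hx)).differentiableAt (by simp)

theorem pd_const (i : Fin n) (c : ℝ) : pd i (fun _ : Pt n => c) x = 0 := by
  simp [pd]

theorem pd_add (i : Fin n) (hφ : DifferentiableAt ℝ φ x) (hψ : DifferentiableAt ℝ ψ x) :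
    pd i (fun y => φ y + ψ y) x = pd i φ x + pd i ψ x := by
  simp [pd, fderiv_fun_add hφ hψ]

theorem pd_mul (i : Fin n) (hφ : DifferentiableAt ℝ φ x) (hψ : DifferentiableAt ℝ ψ x) :
    pd i (fun y => φ y * ψ y) x = φ x * pd i ψ x + ψ x * pd i φ x := by
  simp [pd, fderiv_fun_mul hφ hψ]

theorem pd_const_mul (i : Fin n) (c : ℝ) (hφ : DifferentiableAt ℝ φ x) :
    pd i (fun y => c * φ y) x = c * pd i φ x := by
  simp [pd, fderiv_const_mul hφ]

theorem pd_congr (hU : IsOpen U) (i : Fin n) (h : Set.EqOn φ ψ U) :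
    Set.EqOn (pd i φ) (pd i ψ) U := by
  intro x hx
  have : φ =ᶠ[nhds x] ψ := Filter.eventuallyEq_of_mem (hU.mem_nhds hx) h
  simp only [pd, this.fderiv_eq]

theorem pd_eq_zero (hU : IsOpen U) (i : Fin n) (h : ∀ x ∈ U, φ x = 0) (hx : x ∈ U) :
    pd i φ x = 0 := by
  rw [pd_congr hU i (ψ := fun _ => 0) (fun y hy => h y hy) hx, pd_const]

theorem pd_sum (hU : IsOpen U) (i : Fin n) {ι : Type*} [Fintype ι] {φ : ι → Pt n → ℝ}
    (hφ : ∀ k, ContDiffOn ℝ ∞ (φ k) U) (hx : x ∈ U) :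
    pd i (fun y => ∑ k, φ k y) x = ∑ k, pd i (φ k) x := by
  simp [pd, fderiv_fun_sum fun k _ => differentiableAt_of_contDiffOn hU (hφ k) hx]

theorem contDiffOn_pd (hU : IsOpen U) (i : Fin n) (h : ContDiffOn ℝ ∞ φ U) :
    ContDiffOn ℝ ∞ (pd i φ) U := by
  have h1 : ContDiffOn ℝ ∞ (fderiv ℝ φ) U := h.fderiv_of_isOpen hU (by simp)
  exact h1.clm_apply contDiffOn_const

theorem pd_comm (hU : IsOpen U) (i j : Fin n) (h : ContDiffOn ℝ ∞ φ U) :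
    Set.EqOn (pd i (pd j φ)) (pd j (pd i φ)) U := by
  intro x hx
  have hd : DifferentiableAt ℝ (fderiv ℝ φ) x :=
    ((h.fderiv_of_isOpen hU (m := ∞) (by simp)).contDiffAt (hU.mem_nhds hx)).differentiableAt
      (by simp)
  have key : ∀ k l : Fin n, pd k (pd l φ) x =
      fderiv ℝ (fderiv ℝ φ) x (Pi.single k 1) (Pi.single l 1) := by
    intro k l
    have : pd l φ = fun y => fderiv ℝ φ y (Pi.single l 1) := rfl
    rw [this, pd, fderiv_clm_apply hd (differentiableAt_const _)]
    simp
  rw [key, key]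
  have hs : IsSymmSndFDerivAt ℝ φ x :=
    (h.contDiffAt (hU.mem_nhds hx)).isSymmSndFDerivAt
      (by simpa using WithTop.coe_le_coe.mpr (le_top (a := (2 : ℕ∞))))
  exact hs _ _

end PartialDerivatives

/-! ### Functions that are represented by fractions -/

namespace Poly

/-- No monomial of the polynomial has a common factor with `top`. -/
def lev (top : ℕ) (p : Poly) : Bool := p.all fun t => Nat.beq (Nat.gcd t.1 top) 1

end Poly

namespace Frac

/-- No monomial of the fraction has a common factor with `top`. -/
def lev (top : ℕ) (F : Frac) : Bool := Nat.beq (Nat.gcd F.d top) 1 && F.p.lev top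

end Frac

/-- On `U` the lists `dl i` contain the derivatives of the generators in the direction `i`, for the
generators that do not divide `top`; `env x p` is the value of the generator `p` at `x`. -/
structure IsModel {n : ℕ} (U : Set (Pt n)) (env : Pt n → ℕ → ℝ) (top : ℕ)
    (dl : ℕ → List (List (ℕ × Poly))) : Prop where
  isOpen : IsOpen U
  smooth : ∀ p, ContDiffOn ℝ ∞ (fun x => env x p) U
  prime_dl : ∀ i : Fin n, ∀ d ∈ (dl i).flatten, d.1.Prime
  pd_env : ∀ (i : Fin n) (p : ℕ), p.Prime → ¬ p ∣ top → ∀ x ∈ U,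
    pd i (fun y => env y p) x =
      ((dl i).flatten.map fun d => if d.1 = p then d.2.val (env x) else 0).sum

/-- The function `φ` is represented by the fraction `F` on `U`. -/
def Rep {n : ℕ} (U : Set (Pt n)) (env : Pt n → ℕ → ℝ) (φ : Pt n → ℝ) (F : Frac) : Prop :=
  ∀ x ∈ U, F.Val (env x) (φ x)

section Models

variable {n : ℕ} {U : Set (Pt n)} {env : Pt n → ℕ → ℝ} {top : ℕ} {dl : ℕ → List (List (ℕ × Poly))}

theorem IsModel.smooth_mval (hM : IsModel U env top dl) (m : ℕ) :
    ContDiffOn ℝ ∞ (fun x => mval (env x) m) U := by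
  induction m using Nat.recOnMul with
  | zero => simpa using contDiffOn_const
  | one => simpa using contDiffOn_const
  | prime p hp => simpa only [mval_prime _ hp] using hM.smooth p
  | mul a b ha hb => simpa only [mval_mul] using ha.mul hb

theorem IsModel.smooth_val (hM : IsModel U env top dl) (p : Poly) :
    ContDiffOn ℝ ∞ (fun x => p.val (env x)) U := by
  induction p with
  | nil => simpa using contDiffOn_const
  | cons t p ih => simpa using (contDiffOn_const.mul (hM.smooth_mval t.1)).add ih

/-- Smoothness need not be assumed, because a represented function is a quotient of smooth functions
with nonvanishing denominator. -/
theorem Rep.smooth (hM : IsModel U env top dl) {φ : Pt n → ℝ} {F : Frac} (h : Rep U env φ F) :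
    ContDiffOn ℝ ∞ φ U := by
  have h1 : ContDiffOn ℝ ∞ (fun x => F.p.val (env x) / F.den (env x)) U :=
    (hM.smooth_val F.p).div (contDiffOn_const.mul (hM.smooth_mval F.d)) fun x hx => (h x hx).1
  refine h1.congr fun x hx => ?_
  rw [eq_div_iff (h x hx).1]
  exact (h x hx).2

/-- Induction over the factorisation of `m`: on primes this is the rule for generators, on products
the Leibniz rule. Coprimality to `top` excludes the generators whose derivatives are not available.
-/
theorem IsModel.pd_mval (hM : IsModel U env top dl) (i : Fin n) {x : Pt n} (hx : x ∈ U) (m : ℕ)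
    (hm : m.Coprime top) : pd i (fun y => mval (env y) m) x =
      (Poly.derivTerm (dl i) m 1).val (env x) := by
  rw [Poly.val_derivTerm _ _ (hM.prime_dl i), Int.cast_one, one_mul]
  induction m using Nat.recOnMul with
  | zero => simp [pd_const, -List.map_flatten]
  | one => simp [pd_const, -List.map_flatten]
  | prime p hp =>
    have : ∀ y, mval (env y) p = env y p := fun y => mval_prime _ hp
    simp only [this]
    rw [hM.pd_env i p hp ((hp.coprime_iff_not_dvd).mp hm) x hx]
    congr 1
    refine List.map_congr_left fun d hd => ?_
    split_ifs with h
    · rw [h, hp.factorization_self, Nat.div_self hp.pos]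
      simp
    · have : ¬ d.1 ∣ p := fun hdvd =>
        h ((Nat.prime_dvd_prime_iff_eq (hM.prime_dl i d hd) hp).mp hdvd)
      rw [Nat.factorization_eq_zero_of_not_dvd this]
      simp
  | mul a b iha ihb =>
    have iha := iha hm.coprime_mul_right
    have ihb := ihb hm.coprime_mul_left
    rcases eq_or_ne a 0 with rfl | ha
    · simp [pd_const, -List.map_flatten]
    rcases eq_or_ne b 0 with rfl | hb
    · simp [pd_const, -List.map_flatten]
    simp only [mval_mul]
    rw [pd_mul i (differentiableAt_of_contDiffOn hM.isOpen (hM.smooth_mval a) hx)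
      (differentiableAt_of_contDiffOn hM.isOpen (hM.smooth_mval b) hx), iha, ihb,
      ← List.sum_map_mul_left, ← List.sum_map_mul_left, ← List.sum_map_add]
    congr 1
    refine List.map_congr_left fun d hd => ?_
    have hp := hM.prime_dl i d hd
    rw [Nat.factorization_mul ha hb, Finsupp.add_apply]
    have e1 : (a.factorization d.1 : ℝ) * mval (env x) (a * b / d.1) =
        a.factorization d.1 * (mval (env x) (a / d.1) * mval (env x) b) := by
      by_cases h : d.1 ∣ a
      · rw [← mval_mul, Nat.div_mul_right_comm h]
      · rw [Nat.factorization_eq_zero_of_not_dvd h]; simp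
    have e2 : (b.factorization d.1 : ℝ) * mval (env x) (a * b / d.1) =
        b.factorization d.1 * (mval (env x) a * mval (env x) (b / d.1)) := by
      by_cases h : d.1 ∣ b
      · rw [← mval_mul, Nat.mul_div_assoc _ h]
      · rw [Nat.factorization_eq_zero_of_not_dvd h]; simp
    push_cast
    linear_combination (-(d.2.val (env x))) * e1 - d.2.val (env x) * e2

theorem coprime_of_beq {m k : ℕ} (h : Nat.beq (Nat.gcd m k) 1 = true) : m.Coprime k :=
  Nat.eq_of_beq_eq_true h

theorem IsModel.pd_val (hM : IsModel U env top dl) (i : Fin n) {x : Pt n} (hx : x ∈ U) (p : Poly)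
    (hp : p.lev top = true) :
    pd i (fun y => p.val (env y)) x = (p.deriv (dl i)).val (env x) := by
  induction p with
  | nil => simp [pd_const, Poly.val_deriv]
  | cons t p ih =>
    rw [Poly.lev, List.all_cons, Bool.and_eq_true] at hp
    have hd := differentiableAt_of_contDiffOn hM.isOpen (hM.smooth_mval t.1) hx
    have hd' := differentiableAt_of_contDiffOn hM.isOpen (hM.smooth_val p) hx
    have h1 := hM.pd_mval i hx t.1 (coprime_of_beq hp.1)
    rw [Poly.val_derivTerm _ _ (hM.prime_dl i), Int.cast_one, one_mul] at h1
    simp only [Poly.val_cons]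
    rw [pd_add i (hd.const_mul _) hd', pd_const_mul i _ hd, ih hp.2, Poly.val_deriv,
      Poly.val_deriv, List.map_cons, List.sum_cons,
      Poly.val_derivTerm _ _ (hM.prime_dl i), h1]

/-- Differentiating the identity `φ · denominator = numerator` and solving for the derivative of `φ`
gives the quotient rule. -/
theorem Rep.pd (hM : IsModel U env top dl) (i : Fin n) {φ : Pt n → ℝ} {F : Frac}
    (h : Rep U env φ F) (hF : F.lev top = true) : Rep U env (pd i φ) (F.deriv (dl i)) := by
  intro x hx
  obtain ⟨c, d, p⟩ := F
  rw [Frac.lev, Bool.and_eq_true] at hF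
  have hφ := differentiableAt_of_contDiffOn hM.isOpen (h.smooth hM) hx
  have hm := differentiableAt_of_contDiffOn hM.isOpen (hM.smooth_mval d) hx
  have hden := (h x hx).1
  have hval := (h x hx).2
  have h1 : Set.EqOn (fun y => φ y * (c * mval (env y) d)) (fun y => p.val (env y)) U :=
    fun y hy => (h y hy).2
  have h2 := pd_congr hM.isOpen i h1 hx
  rw [pd_mul i hφ (hm.const_mul _), pd_const_mul i _ hm, hM.pd_val i hx p hF.2,
    hM.pd_mval i hx d (coprime_of_beq hF.1)] at h2
  simp only [Frac.den] at hden hval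
  simp only [Frac.deriv]
  split
  · rename_i h0
    rw [h0] at h2
    refine ⟨hden, ?_⟩
    simp only [Frac.den, ← h2, Poly.val_nil]
    ring
  · rename_i u q h0
    rw [h0] at h2
    have e : (mval (env x) (Nat.mul d d)) = mval (env x) d * mval (env x) d := mval_mul _ _ _
    refine ⟨?_, ?_⟩
    · simp only [Frac.den, e]
      rw [← mul_assoc]
      exact mul_ne_zero hden (right_ne_zero_of_mul hden)
    · simp only [Frac.den, e, Poly.val_add, Poly.val_scale, Poly.val_mul, ← hval, mval_one,
        Int.cast_one, Int.cast_neg]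
      linear_combination (mval (env x) d) * h2

variable {φ ψ : Pt n → ℝ} {F G : Frac}

theorem Rep.congr (h : Rep U env φ F) (e : Set.EqOn ψ φ U) : Rep U env ψ F := fun x hx => by
  rw [e hx]
  exact h x hx

theorem Rep.add (h : Rep U env φ F) (h' : Rep U env ψ G) :
    Rep U env (fun x => φ x + ψ x) (F.add G) := fun x hx => (h x hx).add (h' x hx)

theorem Rep.sub (h : Rep U env φ F) (h' : Rep U env ψ G) :
    Rep U env (fun x => φ x - ψ x) (F.sub G) := fun x hx => (h x hx).sub (h' x hx)

theorem Rep.mul (h : Rep U env φ F) (h' : Rep U env ψ G) :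
    Rep U env (fun x => φ x * ψ x) (F.mul G) := fun x hx => (h x hx).mul (h' x hx)

theorem Rep.reduce (h : Rep U env φ F) : Rep U env φ F.reduce := fun x hx => (h x hx).reduce

theorem Rep.sum {m : ℕ} {φ : Fin m → Pt n → ℝ} {F : ℕ → Frac} (h : ∀ k, Rep U env (φ k) (F k)) :
    Rep U env (fun x => ∑ k, φ k x) (Frac.sumTo m F) :=
  fun x hx => Frac.val_sumTo m F _ fun k => h k x hx

theorem Rep.int (z : ℤ) : Rep U env (fun _ => (z : ℝ)) (Frac.int z) := fun _ _ => Frac.val_int z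

theorem Rep.inv {c : ℕ} (hc : c ≠ 0) : Rep U env (fun _ => 1 / (c : ℝ)) (Frac.inv c 1) :=
  fun _ _ => Frac.val_inv hc

theorem Rep.eq_zero (h : Rep U env φ F) (hF : F.isZero = true) {x : Pt n} (hx : x ∈ U) :
    φ x = 0 := (h x hx).eq_zero hF

end Models

/-! ### The tensors of a metric, computed with fractions -/

namespace Table

open Frac

/-- `p k` holds for all `k < n`. -/
def allTo (n : ℕ) (p : ℕ → Bool) : Bool :=
  Nat.rec true (fun k ih => ih && p k) n

theorem of_allTo {n : ℕ} {p : ℕ → Bool} (h : allTo n p = true) (k : Fin n) : p k = true := by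
  induction n with
  | zero => exact k.elim0
  | succ n ih =>
    have h' : (allTo n p && p n) = true := h
    rw [Bool.and_eq_true] at h'
    refine Fin.lastCases h'.2 (fun j => ih h'.1 j) k

/-- The derivations that are given by the lists `dl i`. -/
noncomputable abbrev dir (dl : ℕ → List (List (ℕ × Poly))) (i : ℕ) : Frac → Frac :=
  Frac.deriv (dl i)

section Definitions

variable (n : ℕ) (D : ℕ → Frac → Frac) (g gi : ℕ → ℕ → Frac)

/-- The Christoffel symbols `Γᵏᵢⱼ` with `i ≤ j`. -/
noncomputable def christoffelLe (k i j : ℕ) : Frac :=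
  reduce (mul (inv 2 1) (sumTo n fun l => mul (gi k l)
    (sub (add (D i (g j l)) (D j (g i l))) (D l (g i j)))))

/-- The connection is torsion-free, so only one half of the symbols is evaluated. -/
noncomputable def christoffel (k i j : ℕ) : Frac :=
  bif Nat.ble i j then christoffelLe n D g gi k i j else christoffelLe n D g gi k j i

/-- The contraction `Γᵏₖⱼ`. -/
noncomputable def christoffelTr (j : ℕ) : Frac :=
  reduce (sumTo n fun k => christoffel n D g gi k k j)

noncomputable def riemannUp (k l i j : ℕ) : Frac :=
  add (sub (D i (christoffel n D g gi k j l)) (D j (christoffel n D g gi k i l)))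
    (sumTo n fun m => sub (mul (christoffel n D g gi k i m) (christoffel n D g gi m j l))
      (mul (christoffel n D g gi k j m) (christoffel n D g gi m i l)))

noncomputable def riemann (i j k l : ℕ) : Frac :=
  sumTo n fun m => mul (g i m) (riemannUp n D g gi m j k l)

/-- The components `Ricⱼₗ` with `j ≤ l`. -/
noncomputable def ricciLe (j l : ℕ) : Frac :=
  reduce (sub (add (sub (sumTo n fun k => D k (christoffel n D g gi k l j))
      (D l (christoffelTr n D g gi j)))
    (sumTo n fun m => mul (christoffelTr n D g gi m) (christoffel n D g gi m l j)))
    (sumTo n fun k => sumTo n fun m =>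
      mul (christoffel n D g gi k l m) (christoffel n D g gi m k j)))

noncomputable def ricci (j l : ℕ) : Frac :=
  bif Nat.ble j l then ricciLe n D g gi j l else ricciLe n D g gi l j

noncomputable def scal : Frac :=
  sumTo n fun i => sumTo n fun j => mul (gi i j) (ricci n D g gi i j)

noncomputable def schouten (i j : ℕ) : Frac :=
  reduce (mul (inv (n - 2) 1) (sub (ricci n D g gi i j)
    (mul (mul (scal n D g gi) (inv (2 * (n - 1)) 1)) (g i j))))

noncomputable def weyl (i j k l : ℕ) : Frac :=
  sub (riemann n D g gi i j k l)
    (add (sub (sub (mul (schouten n D g gi i k) (g j l)) (mul (schouten n D g gi j k) (g i l)))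
      (mul (schouten n D g gi i l) (g j k))) (mul (schouten n D g gi j l) (g i k)))

noncomputable def nabla2 (T : ℕ → ℕ → Frac) (k i j : ℕ) : Frac :=
  sub (sub (D k (T i j)) (sumTo n fun m => mul (christoffel n D g gi m k i) (T m j)))
    (sumTo n fun m => mul (christoffel n D g gi m k j) (T i m))

noncomputable def nabla3 (T : ℕ → ℕ → ℕ → Frac) (l i j k : ℕ) : Frac :=
  sub (sub (sub (D l (T i j k)) (sumTo n fun m => mul (christoffel n D g gi m l i) (T m j k)))
    (sumTo n fun m => mul (christoffel n D g gi m l j) (T i m k)))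
    (sumTo n fun m => mul (christoffel n D g gi m l k) (T i j m))

noncomputable def cotton (i j k : ℕ) : Frac :=
  sub (nabla2 n D g gi (schouten n D g gi) k i j) (nabla2 n D g gi (schouten n D g gi) j i k)

noncomputable def raiseFst (T : ℕ → ℕ → Frac) (k j : ℕ) : Frac :=
  sumTo n fun a => mul (gi k a) (T a j)

noncomputable def raiseBoth (T : ℕ → ℕ → Frac) (k l : ℕ) : Frac :=
  sumTo n fun a => sumTo n fun b => mul (mul (gi k a) (gi l b)) (T a b)

noncomputable def trSchouten : Frac :=
  sumTo n fun k => raiseFst n gi (schouten n D g gi) k k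

noncomputable def schoutenSq (i j : ℕ) : Frac :=
  sumTo n fun k => sumTo n fun l =>
    mul (mul (schouten n D g gi i l) (gi l k)) (schouten n D g gi k j)

noncomputable def bach (i j : ℕ) : Frac :=
  sub (sumTo n fun k => sumTo n fun l =>
      mul (gi k l) (nabla3 n D g gi (cotton n D g gi) l i j k))
    (sumTo n fun k => sumTo n fun l =>
      mul (raiseBoth n gi (schouten n D g gi) k l) (weyl n D g gi k i j l))

/-- `Pᵏₘ Pᵐˡ`. -/
noncomputable def schoutenSqUp (k l : ℕ) : Frac :=
  sumTo n fun m => mul (raiseFst n gi (schouten n D g gi) k m)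
    (raiseBoth n gi (schouten n D g gi) m l)

/-- `Pᵏˡ ∇ₗ Cᵢⱼₖ`. -/
noncomputable def schoutenNablaCotton (i j : ℕ) : Frac :=
  sumTo n fun k => sumTo n fun l => mul (raiseBoth n gi (schouten n D g gi) k l)
    (nabla3 n D g gi (cotton n D g gi) l i j k)

/-- `Cᵏᵢˡ`. -/
noncomputable def cottonUp₁₃ (k i l : ℕ) : Frac :=
  sumTo n fun a => sumTo n fun b => mul (mul (gi k a) (gi l b)) (cotton n D g gi a i b)

/-- `Cᵢᵏˡ`. -/
noncomputable def cottonUp₂₃ (i k l : ℕ) : Frac :=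
  sumTo n fun a => sumTo n fun b => mul (mul (gi k a) (gi l b)) (cotton n D g gi i a b)

/-- `Cᵏᵢˡ Cₗⱼₖ`. -/
noncomputable def cottonSq₁ (i j : ℕ) : Frac :=
  sumTo n fun k => sumTo n fun l =>
    mul (cottonUp₁₃ n D g gi k i l) (cotton n D g gi l j k)

/-- `Cᵢᵏˡ Cⱼₖₗ`. -/
noncomputable def cottonSq₂ (i j : ℕ) : Frac :=
  sumTo n fun k => sumTo n fun l =>
    mul (cottonUp₂₃ n D g gi i k l) (cotton n D g gi j k l)

/-- All entries of a table have only monomials that are prime to `top`. -/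
def lev2 (top : ℕ) (T : ℕ → ℕ → Frac) : Bool :=
  allTo n fun i => allTo n fun j => (T i j).lev top

/-- All entries of a table have only monomials that are prime to `top`. -/
def lev3 (top : ℕ) (T : ℕ → ℕ → ℕ → Frac) : Bool :=
  allTo n fun i => lev2 n top (T i)

/-- All entries of a table vanish. -/
def zero2 (T : ℕ → ℕ → Frac) : Bool :=
  allTo n fun i => allTo n fun j => (T i j).isZero

/-- The Christoffel symbols can be differentiated, and the form `Γᵏₖⱼ` is closed. -/
noncomputable def christoffelCheck (top : ℕ) : Bool :=
  lev3 n top (christoffel n D g gi) && ((allTo n fun j => (christoffelTr n D g gi j).lev top) &&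
    zero2 n fun j l => sub (D l (christoffelTr n D g gi j)) (D j (christoffelTr n D g gi l)))

/-- The Kronecker delta. -/
def delta (i j : ℕ) : Frac := bif Nat.beq i j then int 1 else zero

/-- The tables `g` and `gi` are inverse to each other, the former is symmetric, and the denominators
in the latter divide `u ^ 99`. -/
noncomputable def inverse (u : ℕ) : Bool :=
  (zero2 n fun i j => sub (sumTo n fun k => mul (g i k) (gi k j)) (delta i j)) &&
  ((zero2 n fun i j => sub (g i j) (g j i)) &&
  allTo n fun i => allTo n fun j =>
    !(Nat.beq (gi i j).c 0) && Nat.beq (Nat.mod (Nat.pow u 99) (gi i j).d) 0)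

end Definitions

theorem of_lev2 {n top : ℕ} {T : ℕ → ℕ → Frac} (h : lev2 n top T = true) (i j : Fin n) :
    (T i j).lev top = true := of_allTo (of_allTo h i) j

theorem of_lev3 {n top : ℕ} {T : ℕ → ℕ → ℕ → Frac} (h : lev3 n top T = true) (i j k : Fin n) :
    (T i j k).lev top = true := of_lev2 (of_allTo h i) j k

theorem of_zero2 {n : ℕ} {T : ℕ → ℕ → Frac} (h : zero2 n T = true) (i j : Fin n) :
    (T i j).isZero = true := of_allTo (of_allTo h i) j

end Table

/-! ### The tables represent the tensors -/

section Tables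

variable {n : ℕ} {U : Set (Pt n)} {env : Pt n → ℕ → ℝ} {top : ℕ} {dl : ℕ → List (List (ℕ × Poly))}

theorem Rep.delta (i j : Fin n) :
    Rep U env (fun _ => (1 : Matrix (Fin n) (Fin n) ℝ) i j) (Table.delta i j) := by
  rcases eq_or_ne i j with rfl | h
  · have e : Table.delta i i = Frac.int 1 := by
      simp [Table.delta]
    rw [e]
    simpa using Rep.int (U := U) (env := env) 1
  · have hb : Nat.beq i j = false := by
      rw [← Bool.not_eq_true]
      exact fun hb => h (Fin.ext (Nat.eq_of_beq_eq_true hb))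
    have e : Table.delta i j = Frac.zero := by
      simp [Table.delta, hb]
    rw [e]
    simp only [Matrix.one_apply_ne h]
    exact fun _ _ => Frac.val_zero

/-- The number that a fraction represents. -/
noncomputable def Frac.eval (ρ : ℕ → ℝ) (F : Frac) : ℝ := F.p.val ρ / F.den ρ

theorem Frac.val_eval {ρ : ℕ → ℝ} {F : Frac} {u : ℕ} (hu : mval ρ u ≠ 0)
    (hc : (!(Nat.beq F.c 0)) = true) (hd : Nat.beq (Nat.mod (Nat.pow u 99) F.d) 0 = true) :
    F.Val ρ (F.eval ρ) := by
  have h : F.den ρ ≠ 0 := by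
    refine mul_ne_zero ?_ (mval_ne_zero_of_dvd
      (Nat.dvd_of_mod_eq_zero (Nat.eq_of_beq_eq_true hd)) ?_)
    · rw [Nat.cast_ne_zero]
      intro h0
      rw [h0] at hc
      exact absurd hc (by decide)
    · have e : Nat.pow u 99 = u ^ 99 := rfl
      rw [e, mval_pow]
      exact pow_ne_zero _ hu
  exact ⟨h, div_mul_cancel₀ _ h⟩

variable {g : Pt n → Mat n} {gT giT : ℕ → ℕ → Frac}

section Inverse

variable {u : ℕ} (hg : ∀ i j, Rep U env (fun x => g x i j) (gT i j))
  (hu : ∀ x ∈ U, mval (env x) u ≠ 0) (h : Table.inverse n gT giT u = true)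
include hg hu h

/-- A proposed inverse need only be multiplied with `g` on one side. That its denominators divide a
power of the invertible monomial `u` ensures that its entries have values. -/
theorem mul_inverse_table {x : Pt n} (hx : x ∈ U) :
    g x * Matrix.of (fun i j : Fin n => (giT i j).eval (env x)) = 1 := by
  rw [Table.inverse, Bool.and_eq_true, Bool.and_eq_true] at h
  ext i j
  have hv : ∀ k l : Fin n, (giT k l).Val (env x) ((giT k l).eval (env x)) := fun k l => by
    have := Table.of_allTo (Table.of_allTo h.2.2 k) l
    rw [Bool.and_eq_true] at this
    exact Frac.val_eval (hu x hx) this.1 this.2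
  have h1 := ((Frac.val_sumTo n _ _ fun k => (hg i k x hx).mul (hv k j)).sub
    (Rep.delta (U := U) (env := env) i j x hx)).eq_zero (Table.of_zero2 h.1 i j)
  rw [Matrix.mul_apply]
  exact sub_eq_zero.mp h1

theorem rep_inverse (i j : Fin n) : Rep U env (fun x => (g x)⁻¹ i j) (giT i j) := by
  intro x hx
  beta_reduce
  rw [Matrix.inv_eq_right_inv (mul_inverse_table hg hu h hx)]
  rw [Table.inverse, Bool.and_eq_true, Bool.and_eq_true] at h
  have := Table.of_allTo (Table.of_allTo h.2.2 i) j
  rw [Bool.and_eq_true] at this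
  exact Frac.val_eval (hu x hx) this.1 this.2

theorem isMetricOn_of_table (hM : IsModel U env top dl) : IsMetricOn U g := by
  refine ⟨fun i j => (hg i j).smooth hM, fun x hx => ⟨?_, fun h0 => ?_⟩⟩
  · rw [Table.inverse, Bool.and_eq_true, Bool.and_eq_true] at h
    ext i j
    exact sub_eq_zero.mp (((hg j i x hx).sub (hg i j x hx)).eq_zero (Table.of_zero2 h.2.1 j i))
  · have h1 := congrArg Matrix.det (mul_inverse_table hg hu h hx)
    rw [Matrix.det_mul, h0, zero_mul, Matrix.det_one] at h1
    exact zero_ne_one h1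

end Inverse

theorem christoffel_comm (hU : IsOpen U) (hg : ∀ x ∈ U, (g x).IsSymm) (k i j : Fin n) {x : Pt n}
    (hx : x ∈ U) : christoffel g k i j x = christoffel g k j i x := by
  rw [christoffel, christoffel]
  congr 1
  refine Finset.sum_congr rfl fun l _ => ?_
  have h : Set.EqOn (fun y => g y i j) (fun y => g y j i) U := fun y hy => (hg y hy).apply j i
  rw [pd_congr hU l h hx, add_comm]

section Ricci

variable (hU : IsOpen U) (hs : ∀ i k j, ContDiffOn ℝ ∞ (christoffel g i k j) U)
include hU hs

/-- Contracting before multiplying leaves only the trace `Γᵏₖⱼ` in two of the four sums, which makes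
the evaluation cheaper. -/
theorem ricci_eq {x : Pt n} (hx : x ∈ U) (j l : Fin n) :
    ricci g x j l = ∑ k, pd k (christoffel g k l j) x - pd l (fun x => ∑ k, christoffel g k k j x) x
      + ∑ m, (∑ k, christoffel g k k m x) * christoffel g m l j x
      - ∑ k, ∑ m, christoffel g k l m x * christoffel g m k j x := by
  have h : pd l (fun x => ∑ k, christoffel g k k j x) x = ∑ k, pd l (christoffel g k k j) x :=
    pd_sum hU l (fun k => hs k k j) hx
  rw [h]
  simp only [ricci, Matrix.of_apply, riemannUp, Finset.sum_add_distrib, Finset.sum_sub_distrib,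
    Finset.sum_mul]
  rw [Finset.sum_comm (f := fun k m => christoffel g k k m x * christoffel g m l j x)]
  ring

/-- For a torsion-free connection the skew part of the Ricci tensor is the curl of `Γᵏₖⱼ`. Here `hc`
is the closedness of this form, which is checked on the tables. -/
theorem ricci_comm (hg : ∀ x ∈ U, (g x).IsSymm)
    (hc : ∀ l j, ∀ x ∈ U, pd l (fun x => ∑ k, christoffel g k k j x) x =
      pd j (fun x => ∑ k, christoffel g k k l x) x) {x : Pt n} (hx : x ∈ U) (j l : Fin n) :
    ricci g x j l = ricci g x l j := by
  rw [ricci_eq hU hs hx, ricci_eq hU hs hx, hc l j x hx]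
  have hΓ : ∀ k i j, christoffel g k i j x = christoffel g k j i x :=
    fun k i j => christoffel_comm hU hg k i j hx
  have h1 : ∀ k, pd k (christoffel g k l j) x = pd k (christoffel g k j l) x := fun k =>
    pd_congr hU k (fun y hy => christoffel_comm hU hg k l j hy) hx
  simp only [h1, hΓ _ l j]
  congr 1
  rw [Finset.sum_comm]
  refine Finset.sum_congr rfl fun k _ => Finset.sum_congr rfl fun m _ => ?_
  rw [hΓ m l k, hΓ k m j, mul_comm]

end Ricci

/-- The tables `gT` and `giT` represent the metric `g` and its inverse. -/
structure RepMetric (U : Set (Pt n)) (env : Pt n → ℕ → ℝ) (top : ℕ)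
    (dl : ℕ → List (List (ℕ × Poly))) (g : Pt n → Mat n) (gT giT : ℕ → ℕ → Frac) : Prop where
  model : IsModel U env top dl
  symm : ∀ x ∈ U, (g x).IsSymm
  metric : ∀ i j, Rep U env (fun x => g x i j) (gT i j)
  inverse : ∀ i j, Rep U env (fun x => (g x)⁻¹ i j) (giT i j)

theorem repMetric_of_table (hM : IsModel U env top dl)
    (hg : ∀ i j, Rep U env (fun x => g x i j) (gT i j)) {u : ℕ}
    (hu : ∀ x ∈ U, mval (env x) u ≠ 0) (h : Table.inverse n gT giT u = true) :
    RepMetric U env top dl g gT giT :=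
  ⟨hM, fun x hx => ((isMetricOn_of_table hg hu h hM).2 x hx).1, hg, rep_inverse hg hu h⟩

/-! ### Curvature tensors of a represented metric -/

namespace RepMetric

variable (R : RepMetric U env top dl g gT giT)
include R

section First

variable (hg : Table.lev2 n top gT = true)
include hg

theorem christoffel (k i j : Fin n) :
    Rep U env (christoffel g k i j) (Table.christoffel n (Table.dir dl) gT giT k i j) := by
  have hd : ∀ l i j, Rep U env (pd l fun y => g y i j) ((gT i j).deriv (dl l)) :=
    fun l i j => (R.metric i j).pd R.model l (Table.of_lev2 hg i j)
  have h2 : Rep U env (fun _ => (1 / 2 : ℝ)) (Frac.inv 2 1) := by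
    simpa using Rep.inv (U := U) (env := env) two_ne_zero
  have h3 : ∀ i j : Fin n, Rep U env (BryantConf.christoffel g k i j)
      (Table.christoffelLe n (Table.dir dl) gT giT k i j) := fun i j => Rep.reduce
    (h2.mul (Rep.sum fun l => (R.inverse k l).mul (((hd i j l).add (hd j i l)).sub (hd l i j))))
  rw [Table.christoffel]
  cases Nat.ble i j with
  | true => exact h3 i j
  | false => exact (h3 j i).congr fun x hx => christoffel_comm R.model.isOpen R.symm k i j hx

theorem christoffelTr (j : Fin n) :
    Rep U env (fun x => ∑ k, BryantConf.christoffel g k k j x)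
      (Table.christoffelTr n (Table.dir dl) gT giT j) :=
  Rep.reduce (Rep.sum fun k => R.christoffel hg k k j)

theorem nabla2 {T : Pt n → Mat n} {TT : ℕ → ℕ → Frac}
    (hT : ∀ i j, Rep U env (fun x => T x i j) (TT i j)) (k i j : Fin n)
    (hl : (TT i j).lev top = true) :
    Rep U env (fun x => nabla2 g T x k i j) (Table.nabla2 n (Table.dir dl) gT giT TT k i j) :=
  (((hT i j).pd R.model k hl).sub
    (Rep.sum fun m => (R.christoffel hg m k i).mul (hT m j))).sub
    (Rep.sum fun m => (R.christoffel hg m k j).mul (hT i m))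

theorem nabla3 {T : Pt n → Fin n → Fin n → Fin n → ℝ} {TT : ℕ → ℕ → ℕ → Frac}
    (hT : ∀ i j k, Rep U env (fun x => T x i j k) (TT i j k))
    (hl : Table.lev3 n top TT = true) (l i j k : Fin n) :
    Rep U env (fun x => nabla3 g T x l i j k) (Table.nabla3 n (Table.dir dl) gT giT TT l i j k) :=
  ((((hT i j k).pd R.model l (Table.of_lev3 hl i j k)).sub
    (Rep.sum fun m => (R.christoffel hg m l i).mul (hT m j k))).sub
    (Rep.sum fun m => (R.christoffel hg m l j).mul (hT i m k))).sub
    (Rep.sum fun m => (R.christoffel hg m l k).mul (hT i j m))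

section Second

variable (hΓ : Table.christoffelCheck n (Table.dir dl) gT giT top = true)
include hΓ

theorem pd_christoffel (m k i j : Fin n) : Rep U env (pd m (BryantConf.christoffel g k i j))
    ((Table.christoffel n (Table.dir dl) gT giT k i j).deriv (dl m)) :=
  (R.christoffel hg k i j).pd R.model m
    (Table.of_lev3 (Bool.and_eq_true_iff.mp hΓ).1 k i j)

theorem riemannUp (k l i j : Fin n) :
    Rep U env (fun x => riemannUp g x k l i j)
      (Table.riemannUp n (Table.dir dl) gT giT k l i j) := by
  exact ((R.pd_christoffel hg hΓ i k j l).sub (R.pd_christoffel hg hΓ j k i l)).add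
    (Rep.sum fun m =>
    ((R.christoffel hg k i m).mul (R.christoffel hg m j l)).sub
      ((R.christoffel hg k j m).mul (R.christoffel hg m i l)))

theorem riemann (i j k l : Fin n) :
    Rep U env (fun x => riemann g x i j k l) (Table.riemann n (Table.dir dl) gT giT i j k l) :=
  Rep.sum fun m => (R.metric i m).mul (R.riemannUp hg hΓ m j k l)

theorem ricci (j l : Fin n) :
    Rep U env (fun x => ricci g x j l) (Table.ricci n (Table.dir dl) gT giT j l) := by
  have hΓ' := hΓ
  rw [Table.christoffelCheck, Bool.and_eq_true, Bool.and_eq_true] at hΓ'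
  have hs : ∀ i k j, ContDiffOn ℝ ∞ (BryantConf.christoffel g i k j) U :=
    fun i k j => (R.christoffel hg i k j).smooth R.model
  have ht : ∀ l j : Fin n, Rep U env (pd l fun x => ∑ k, BryantConf.christoffel g k k j x)
      ((Table.christoffelTr n (Table.dir dl) gT giT j).deriv (dl l)) := fun l j =>
    (R.christoffelTr hg j).pd R.model l (Table.of_allTo hΓ'.2.1 j)
  have hc : ∀ l j : Fin n, ∀ x ∈ U, pd l (fun x => ∑ k, BryantConf.christoffel g k k j x) x =
      pd j (fun x => ∑ k, BryantConf.christoffel g k k l x) x := fun l j x hx =>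
    sub_eq_zero.mp (((ht l j x hx).sub (ht j l x hx)).eq_zero (Table.of_zero2 hΓ'.2.2 j l))
  have h1 : ∀ j l : Fin n, Rep U env (fun x => BryantConf.ricci g x j l)
      (Table.ricciLe n (Table.dir dl) gT giT j l) := fun j l => by
    refine Rep.congr (Rep.reduce (Rep.sub (Rep.add (Rep.sub
      (Rep.sum fun k => R.pd_christoffel hg hΓ k k l j) (ht l j))
      (Rep.sum fun m => (R.christoffelTr hg m).mul (R.christoffel hg m l j)))
      (Rep.sum fun k => Rep.sum fun m =>
        (R.christoffel hg k l m).mul (R.christoffel hg m k j)))) ?_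
    exact fun x hx => ricci_eq R.model.isOpen hs hx j l
  rw [Table.ricci]
  cases Nat.ble j l with
  | true => exact h1 j l
  | false =>
    exact (h1 l j).congr fun x hx => ricci_comm R.model.isOpen hs R.symm hc hx j l

theorem scal : Rep U env (scal g) (Table.scal n (Table.dir dl) gT giT) :=
  Rep.sum fun i => Rep.sum fun j => (R.inverse i j).mul (R.ricci hg hΓ i j)

variable (hn : 2 < n)
include hn

theorem schouten (i j : Fin n) :
    Rep U env (fun x => schouten g x i j) (Table.schouten n (Table.dir dl) gT giT i j) := by
  have h1 : Rep U env (fun _ => 1 / ((n : ℝ) - 2)) (Frac.inv (n - 2) 1) := by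
    have := Rep.inv (U := U) (env := env) (c := n - 2) (by omega)
    rwa [Nat.cast_sub hn.le] at this
  have h2 : Rep U env (fun _ => 1 / (2 * ((n : ℝ) - 1))) (Frac.inv (2 * (n - 1)) 1) := by
    have := Rep.inv (U := U) (env := env) (c := 2 * (n - 1)) (by omega)
    rwa [Nat.cast_mul, Nat.cast_sub (by omega : 1 ≤ n), Nat.cast_one, Nat.cast_ofNat] at this
  refine Rep.congr (Rep.reduce
    (h1.mul ((R.ricci hg hΓ i j).sub (((R.scal hg hΓ).mul h2).mul (R.metric i j))))) ?_
  intro x _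
  simp [BryantConf.schouten, div_eq_mul_inv]

theorem weyl (i j k l : Fin n) :
    Rep U env (fun x => weyl g x i j k l) (Table.weyl n (Table.dir dl) gT giT i j k l) := by
  have hP := R.schouten hg hΓ hn
  exact (R.riemann hg hΓ i j k l).sub (((((hP i k).mul (R.metric j l)).sub
    ((hP j k).mul (R.metric i l))).sub ((hP i l).mul (R.metric j k))).add
    ((hP j l).mul (R.metric i k)))

theorem raiseFst (k j : Fin n) :
    Rep U env (fun x => raiseFst g (BryantConf.schouten g) x k j)
      (Table.raiseFst n giT (Table.schouten n (Table.dir dl) gT giT) k j) :=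
  Rep.sum fun a => (R.inverse k a).mul (R.schouten hg hΓ hn a j)

theorem raiseBoth (k l : Fin n) :
    Rep U env (fun x => raiseBoth g (BryantConf.schouten g) x k l)
      (Table.raiseBoth n giT (Table.schouten n (Table.dir dl) gT giT) k l) :=
  Rep.sum fun a => Rep.sum fun b =>
    ((R.inverse k a).mul (R.inverse l b)).mul (R.schouten hg hΓ hn a b)

theorem trSchouten : Rep U env (trSchouten g) (Table.trSchouten n (Table.dir dl) gT giT) :=
  Rep.sum fun k => R.raiseFst hg hΓ hn k k

theorem schoutenSq (i j : Fin n) :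
    Rep U env (fun x => schoutenSq g x i j) (Table.schoutenSq n (Table.dir dl) gT giT i j) :=
  Rep.sum fun k => Rep.sum fun l =>
    ((R.schouten hg hΓ hn i l).mul (R.inverse l k)).mul (R.schouten hg hΓ hn k j)

theorem schoutenSqUp (k l : Fin n) :
    Rep U env (fun x => ∑ m, BryantConf.raiseFst g (BryantConf.schouten g) x k m *
      BryantConf.raiseBoth g (BryantConf.schouten g) x m l)
      (Table.schoutenSqUp n (Table.dir dl) gT giT k l) :=
  Rep.sum fun m => (R.raiseFst hg hΓ hn k m).mul (R.raiseBoth hg hΓ hn m l)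

/-- A single Cotton component differentiates only two components of the Schouten tensor, so for the
rescaled metric only those two have to be free of generators of highest order. -/
theorem cotton_of_lev (i j k : Fin n)
    (hj : (Table.schouten n (Table.dir dl) gT giT i j).lev top = true)
    (hk : (Table.schouten n (Table.dir dl) gT giT i k).lev top = true) :
    Rep U env (fun x => cotton g x i j k) (Table.cotton n (Table.dir dl) gT giT i j k) :=
  (R.nabla2 hg (R.schouten hg hΓ hn) k i j hj).sub (R.nabla2 hg (R.schouten hg hΓ hn) j i k hk)

section Third

variable (hP : Table.lev2 n top (Table.schouten n (Table.dir dl) gT giT) = true)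
include hP

theorem cotton (i j k : Fin n) :
    Rep U env (fun x => cotton g x i j k) (Table.cotton n (Table.dir dl) gT giT i j k) :=
  R.cotton_of_lev hg hΓ hn i j k (Table.of_lev2 hP i j) (Table.of_lev2 hP i k)

theorem cottonSq₁ (i j : Fin n) :
    Rep U env (fun x => ∑ k, ∑ l, (∑ a, ∑ b, (g x)⁻¹ k a * (g x)⁻¹ l b *
      BryantConf.cotton g x a i b) * BryantConf.cotton g x l j k)
      (Table.cottonSq₁ n (Table.dir dl) gT giT i j) :=
  Rep.sum fun k => Rep.sum fun l => Rep.mul (Rep.sum fun a => Rep.sum fun b =>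
    ((R.inverse k a).mul (R.inverse l b)).mul (R.cotton hg hΓ hn hP a i b))
    (R.cotton hg hΓ hn hP l j k)

theorem cottonSq₂ (i j : Fin n) :
    Rep U env (fun x => ∑ k, ∑ l, (∑ a, ∑ b, (g x)⁻¹ k a * (g x)⁻¹ l b *
      BryantConf.cotton g x i a b) * BryantConf.cotton g x j k l)
      (Table.cottonSq₂ n (Table.dir dl) gT giT i j) :=
  Rep.sum fun k => Rep.sum fun l => Rep.mul (Rep.sum fun a => Rep.sum fun b =>
    ((R.inverse k a).mul (R.inverse l b)).mul (R.cotton hg hΓ hn hP i a b))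
    (R.cotton hg hΓ hn hP j k l)

variable (hC : Table.lev3 n top (Table.cotton n (Table.dir dl) gT giT) = true)
include hC

theorem bach (i j : Fin n) :
    Rep U env (fun x => bach g x i j) (Table.bach n (Table.dir dl) gT giT i j) :=
  Rep.sub (Rep.sum fun k => Rep.sum fun l => (R.inverse k l).mul
    (R.nabla3 hg (R.cotton hg hΓ hn hP) hC l i j k))
  (Rep.sum fun k => Rep.sum fun l =>
    (R.raiseBoth hg hΓ hn k l).mul (R.weyl hg hΓ hn k i j l))

theorem schoutenNablaCotton (i j : Fin n) :
    Rep U env (fun x => ∑ k, ∑ l, BryantConf.raiseBoth g (BryantConf.schouten g) x k l *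
      BryantConf.nabla3 g (BryantConf.cotton g) x l i j k)
      (Table.schoutenNablaCotton n (Table.dir dl) gT giT i j) :=
  Rep.sum fun k => Rep.sum fun l => (R.raiseBoth hg hΓ hn k l).mul
    (R.nabla3 hg (R.cotton hg hΓ hn hP) hC l i j k)

end Third

end Second

end First

end RepMetric

end Tables

/-! ### Generators

The coordinates have names: `t` has the name `0`, the coordinates `x` of a point of `ℝ⁶` have the
names `1, …, 6`, and `ϱ` has the name `7`. -/

/-- The generators: coordinates, partial derivatives of `f`, partial derivatives of `φ` and
`exp (2 φ)`. -/
inductive Var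
  | coord (j : ℕ)
  | jet (r s : ℕ)
  | pot (l : List ℕ)
  | expo
deriving DecidableEq

namespace Var

/-- The generators that are used, in groups. -/
def groups : List (List Var) :=
  ((List.range 7).map fun k => (List.range (k + 1)).map fun s => jet (k - s) s) ++
  ([[coord 0, coord 1, coord 2, coord 7, expo], (List.range' 1 6).map fun i => pot [i]] ++
  (((List.range' 1 6).map fun i => (List.range' i (7 - i)).map fun j => pot [i, j]) ++
  ((List.range' 1 6).flatMap fun i => (List.range' i (7 - i)).map fun j =>
    (List.range' j (7 - j)).map fun k => pot [i, j, k])))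

/-- The generators that are used. -/
def all : List Var := groups.flatten

/-- The primes that code the generators. -/
def primes : List ℕ :=
  [2, 3, 5, 7, 11, 13, 17, 19, 23, 29, 31, 37, 41, 43, 47, 53, 59, 61, 67, 71, 73, 79, 83, 89,
    97, 101, 103, 107, 109, 113, 127, 131, 137, 139, 149, 151, 157, 163, 167, 173, 179, 181, 191,
    193, 197, 199, 211, 223, 227, 229, 233, 239, 241, 251, 257, 263, 269, 271, 277, 281, 283,
    293, 307, 311, 313, 317, 331, 337, 347, 349, 353, 359, 367, 373, 379, 383, 389, 397, 401,
    409, 419, 421, 431, 433, 439, 443, 449, 457, 461, 463, 467, 479, 487, 491, 499, 503, 509,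
    521, 523, 541, 547, 557, 563, 569, 571, 577, 587, 593, 599, 601, 607, 613, 617, 619, 631, 641]

/-- The code of a generator. -/
def code (v : Var) : ℕ := primes.getD (all.idxOf v) 0

/-- The generators of highest order, the derivatives of which are not generators. -/
def isTop : Var → Bool
  | jet r s => Nat.beq (Nat.add r s) 6
  | pot l => Nat.beq l.length 3
  | _ => false

/-- The product of the codes of the generators of highest order. -/
def top : ℕ := (all.filter isTop).foldr (fun v m => Nat.mul (code v) m) 1

/-- Insertion into an ordered list. -/
def insert (k : ℕ) : List ℕ → List ℕ
  | [] => [k]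
  | m :: l => bif Nat.ble k m then k :: m :: l else m :: insert k l

/-- The derivative of a generator with respect to the coordinate with the name `k`, for a function
`f` of the coordinates with the names `a` and `3`. Without `hat` the function `φ` is constant. -/
def diff (hat : Bool) (a k : ℕ) : Var → Poly
  | coord j => bif Nat.beq k j then [(1, 1)] else []
  | jet r s => bif Nat.beq k a then [(code (jet (Nat.succ r) s), 1)]
      else bif Nat.beq k 3 then [(code (jet r (Nat.succ s)), 1)] else []
  | pot l => bif hat then [(code (pot (insert k l)), 1)] else []
  | expo => bif hat then [(Nat.mul (code (pot [k])) (code expo), 2)] else []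

/-- The list of the generators with non-zero derivatives, and these derivatives. -/
def diffList (hat : Bool) (a k : ℕ) : List (List (ℕ × Poly)) :=
  groups.map fun l => (l.map fun v => (code v, diff hat a k v)).filter fun d => !d.2.isEmpty

theorem flatten_diffList (hat : Bool) (a k : ℕ) : (diffList hat a k).flatten =
    (all.map fun v => (code v, diff hat a k v)).filter fun d => !d.2.isEmpty := by
  rw [all, List.map_flatten, List.filter_flatten, diffList, List.map_map]
  rfl

/-- The value of the generator with the code `p`, if the generators have the values `w`. -/
noncomputable def env (w : Var → ℝ) (p : ℕ) : ℝ :=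
  match all[primes.idxOf p]? with
  | some v => w v
  | none => 1

theorem prime_of_mem {p : ℕ} (hp : p ∈ primes) : p.Prime := by
  revert p
  simp only [primes, List.forall_mem_cons]
  norm_num

theorem nodup_primes : primes.Nodup := by decide +kernel

theorem nodup_all : all.Nodup := by decide +kernel

theorem length_all : all.length = primes.length := by decide +kernel

variable {v : Var}

theorem code_eq_getElem (hv : v ∈ all) :
    code v = primes[all.idxOf v]'(length_all ▸ List.idxOf_lt_length_of_mem hv) :=
  List.getD_eq_getElem _ _ _

theorem prime_code (hv : v ∈ all) : (code v).Prime := by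
  rw [code_eq_getElem hv]
  exact prime_of_mem (List.getElem_mem _)

theorem env_code (w : Var → ℝ) (hv : v ∈ all) : env w (code v) = w v := by
  have h : all[primes.idxOf (code v)]? = some v := by
    rw [code_eq_getElem hv, nodup_primes.idxOf_getElem,
      List.getElem?_eq_getElem (List.idxOf_lt_length_of_mem hv), List.getElem_idxOf]
  rw [env, h]

theorem mval_code (w : Var → ℝ) (hv : v ∈ all) : mval (env w) (code v) = w v := by
  rw [mval_prime _ (prime_code hv), env_code w hv]

theorem exists_code_eq {p : ℕ} (h : all[primes.idxOf p]? = some v) : v ∈ all ∧ code v = p := by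
  have hv := List.mem_of_getElem? h
  refine ⟨hv, ?_⟩
  obtain ⟨hk, hv'⟩ := List.getElem?_eq_some_iff.mp h
  have hk' : primes.idxOf p < primes.length := length_all ▸ hk
  rw [code_eq_getElem hv]
  have : all.idxOf v = primes.idxOf p := by
    rw [← hv', nodup_all.idxOf_getElem]
  simp only [this]
  exact List.getElem_idxOf hk'

/-- The assignment that is `1` at `v'` and `0` elsewhere can be read off from the codes, so it
separates them. -/
theorem code_injective {v' : Var} (hv : v ∈ all) (hv' : v' ∈ all) (h : code v = code v') :
    v = v' := by
  have h1 := env_code (fun u => if u = v' then 1 else 0) hv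
  have h2 := env_code (fun u => if u = v' then 1 else 0) hv'
  rw [h, h2] at h1
  by_contra hne
  simp [hne] at h1

/-- The derivatives of a generator are polynomials in the generators. -/
def closed : Var → Bool
  | coord _ => true
  | jet r s => decide (jet (r + 1) s ∈ all ∧ jet r (s + 1) ∈ all)
  | pot l => decide (∀ k ∈ List.range' 1 6, pot (insert k l) ∈ all)
  | expo => decide (∀ k ∈ List.range' 1 6, pot [k] ∈ all)

theorem isTop_or_closed : ∀ v ∈ all, isTop v = true ∨ closed v = true := by decide +kernel

theorem code_dvd_top (hv : v ∈ all) (h : isTop v = true) : code v ∣ top := by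
  have h1 : ∀ l : List Var, v ∈ l → code v ∣ l.foldr (fun v m => Nat.mul (code v) m) 1 := by
    intro l hl
    induction l with
    | nil => exact absurd hl List.not_mem_nil
    | cons u l ih =>
      rcases List.mem_cons.mp hl with rfl | hl
      · exact Dvd.intro _ rfl
      · exact Dvd.dvd.mul_left (ih hl) (code u)
  exact h1 _ (List.mem_filter.mpr ⟨hv, h⟩)

/-- The value of the derivative of a generator. -/
noncomputable def diffVal (hat : Bool) (a k : ℕ) (w : Var → ℝ) : Var → ℝ
  | coord j => if k = j then 1 else 0
  | jet r s => if k = a then w (jet (r + 1) s) else if k = 3 then w (jet r (s + 1)) else 0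
  | pot l => if hat then w (pot (insert k l)) else 0
  | expo => if hat then 2 * (w (pot [k]) * w expo) else 0

theorem val_diff (hat : Bool) (a k : ℕ) (hk : hat = true → 0 < k ∧ k < 7) (w : Var → ℝ)
    (hv : v ∈ all) (ht : isTop v = false) :
    (diff hat a k v).val (env w) = diffVal hat a k w v := by
  have hb : ∀ i j : ℕ, Nat.beq i j = decide (i = j) := fun i j => by
    rw [Bool.eq_iff_iff]
    simp
  have hc := (isTop_or_closed v hv).resolve_left (by simp [ht])
  cases v with
  | coord j => by_cases h : k = j <;> simp [diff, diffVal, hb, h]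
  | jet r s =>
    have hc := of_decide_eq_true hc
    have h1 := mval_code w hc.1
    have h2 := mval_code w hc.2
    by_cases h : k = a
    · simp [diff, diffVal, hb, h, h1]
    · by_cases h' : k = 3
      · rw [h'] at h
        simp [diff, diffVal, hb, h, h', h2]
      · simp [diff, diffVal, hb, h, h']
  | pot l =>
    cases hat with
    | false => simp [diff, diffVal]
    | true =>
      obtain ⟨h0, h7⟩ := hk rfl
      have h1 := mval_code w (of_decide_eq_true hc k (List.mem_range'_1.mpr ⟨h0, h7⟩))
      simp [diff, diffVal, h1]
  | expo =>
    cases hat with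
    | false => simp [diff, diffVal]
    | true =>
      obtain ⟨h0, h7⟩ := hk rfl
      have hc : ∀ k ∈ List.range' 1 6, pot [k] ∈ all := of_decide_eq_true (by exact hc)
      have h1 := mval_code w (hc k (List.mem_range'_1.mpr ⟨h0, h7⟩))
      have h2 := mval_code w hv
      have h3 := mval_mul (env w) (code (pot [k])) (code expo)
      simp only [diff, diffVal, cond_true, Poly.val_cons, Poly.val_nil, if_true]
      rw [show Nat.mul (code (pot [k])) (code expo) = code (pot [k]) * code expo from rfl, h3, h1,
        h2]
      push_cast
      ring

theorem sum_diffList (hat : Bool) (a k : ℕ) (ρ : ℕ → ℝ) (p : ℕ) :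
    ((diffList hat a k).flatten.map fun d => if d.1 = p then d.2.val ρ else 0).sum =
      (all.map fun v => if code v = p then (diff hat a k v).val ρ else 0).sum := by
  rw [flatten_diffList]
  generalize all = l
  induction l with
  | nil => simp
  | cons v l ih =>
    rw [List.map_cons, List.filter_cons]
    by_cases h : diff hat a k v = []
    · simp [h, ih]
    · simp [h, ih]

theorem sum_all {p : ℕ} (hv : v ∈ all) (hp : code v = p) (F : Var → ℝ) :
    (all.map fun u => if code u = p then F u else 0).sum = F v := by
  have h : (all.map fun u => if code u = p then F u else 0) =
      all.map fun u => if u = v then F u else 0 := by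
    refine List.map_congr_left fun u hu => ?_
    by_cases e : u = v
    · rw [if_pos e, if_pos (e ▸ hp)]
    · rw [if_neg e, if_neg fun h => e (code_injective hu hv (h.trans hp.symm))]
  rw [h, ← List.sum_toFinset _ nodup_all, Finset.sum_ite_eq' all.toFinset v F,
    if_pos (List.mem_toFinset.mpr hv)]

/-- The offset `o` translates indices of coordinates into names: it is `1` on the base, where names
start with that of `x¹`, and `0` on the ambient space, where index `0` is `t`. The bounds in `ho`
keep the indices of derivatives of `φ` between `1` and `6`. -/
theorem isModel {n : ℕ} {U : Set (Pt n)} (hU : IsOpen U) (hat : Bool) (a o : ℕ)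
    (ho : hat = true → 0 < o ∧ n + o ≤ 7) (w : Pt n → Var → ℝ)
    (hw : ∀ v, ContDiffOn ℝ ∞ (fun x => w x v) U)
    (hd : ∀ (i : Fin n) (v : Var), ∀ x ∈ U,
      pd i (fun y => w y v) x = diffVal hat a (i + o) (w x) v) :
    IsModel U (fun x => env (w x)) top (fun i => diffList hat a (i + o)) where
  isOpen := hU
  smooth p := by
    unfold env
    cases all[primes.idxOf p]? with
    | none => exact contDiffOn_const
    | some v => exact hw v
  prime_dl i d h := by
    rw [flatten_diffList] at h
    obtain ⟨v, hv, rfl⟩ := List.mem_map.mp (List.mem_filter.mp h).1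
    exact prime_code hv
  pd_env i p _ hp x hx := by
    rw [sum_diffList]
    cases h : all[primes.idxOf p]? with
    -- A prime that codes no generator has the constant value `1`, and no entry of the list has it
    -- as key.
    | none =>
      have h1 : (fun y => env (w y) p) = fun _ => 1 := by
        funext y
        rw [env, h]
      rw [h1, pd_const, eq_comm]
      refine List.sum_eq_zero fun z hz => ?_
      obtain ⟨u, hu, rfl⟩ := List.mem_map.mp hz
      refine if_neg fun e => ?_
      have h2 := env_code (fun _ => 0) hu
      rw [e, env, h] at h2
      exact one_ne_zero h2
    | some v =>
      obtain ⟨hv, rfl⟩ := exists_code_eq h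
      have h1 : (fun y => env (w y) (code v)) = fun y => w y v := by
        funext y
        exact env_code _ hv
      have ht : isTop v = false := by
        rw [← Bool.not_eq_true]
        exact fun h => hp (code_dvd_top hv h)
      rw [h1, hd i v x hx, sum_all hv rfl]
      exact (val_diff hat a _ (fun h => ⟨by have := (ho h).1; omega,
        by have := (ho h).2; have := i.2; omega⟩) _ hv ht).symm

end Var

/-! ### The generators as functions on `ℝ⁶` and on the ambient space -/

section Iterated

variable {n : ℕ} {U : Set (Pt n)} {φ ψ : Pt n → ℝ}

theorem pd_coord (i j : Fin n) (x : Pt n) : pd i (fun y => y j) x = if i = j then 1 else 0 := by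
  have h : (fun y : Pt n => y j) = ContinuousLinearMap.proj (R := ℝ) (φ := fun _ => ℝ) j := rfl
  rw [pd, h, ContinuousLinearMap.fderiv, ContinuousLinearMap.proj_apply, Pi.single_apply]
  simp only [eq_comm]

theorem contDiffOn_iterate_pd (hU : IsOpen U) (i : Fin n) (k : ℕ) (h : ContDiffOn ℝ ∞ φ U) :
    ContDiffOn ℝ ∞ ((pd i)^[k] φ) U := by
  induction k with
  | zero => exact h
  | succ k ih =>
    rw [Function.iterate_succ_apply']
    exact contDiffOn_pd hU i ih

theorem iterate_pd_congr (hU : IsOpen U) (i : Fin n) (k : ℕ) (h : Set.EqOn φ ψ U) :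
    Set.EqOn ((pd i)^[k] φ) ((pd i)^[k] ψ) U := by
  induction k with
  | zero => exact h
  | succ k ih =>
    rw [Function.iterate_succ_apply', Function.iterate_succ_apply']
    exact pd_congr hU i ih

theorem pd_iterate_pd (hU : IsOpen U) (i j : Fin n) (k : ℕ) (h : ContDiffOn ℝ ∞ φ U) :
    Set.EqOn (pd j ((pd i)^[k] φ)) ((pd i)^[k] (pd j φ)) U := by
  induction k with
  | zero => exact fun _ _ => rfl
  | succ k ih =>
    rw [Function.iterate_succ_apply', Function.iterate_succ_apply']
    exact (pd_comm hU j i (contDiffOn_iterate_pd hU i k h)).trans (pd_congr hU i ih)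

theorem iterate_pd_zero (i : Fin n) (k : ℕ) : (pd i)^[k] (fun _ => (0 : ℝ)) = fun _ => 0 := by
  induction k with
  | zero => rfl
  | succ k ih =>
    rw [Function.iterate_succ_apply', ih]
    funext x
    exact pd_const i 0

/-- The derivatives of `φ` in the directions that are listed. -/
noncomputable def listPd (φ : Pt n → ℝ) : List ℕ → Pt n → ℝ
  | [] => φ
  | k :: l => fun x => if h : k - 1 < n then pd ⟨k - 1, h⟩ (listPd φ l) x else 0

theorem contDiffOn_listPd (hU : IsOpen U) (h : ContDiffOn ℝ ∞ φ U) (l : List ℕ) :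
    ContDiffOn ℝ ∞ (listPd φ l) U := by
  induction l with
  | nil => exact h
  | cons k l ih =>
    unfold listPd
    split_ifs with hk
    · exact contDiffOn_pd hU _ ih
    · exact contDiffOn_const

/-- Partial derivatives commute, so each one is named by its ordered list of directions. A further
derivative is moved to its place by swapping neighbours. -/
theorem pd_listPd (hU : IsOpen U) (h : ContDiffOn ℝ ∞ φ U) (i : Fin n) (l : List ℕ) :
    Set.EqOn (pd i (listPd φ l)) (listPd φ (Var.insert (i + 1) l)) U := by
  have key : ∀ l, listPd φ ((i + 1) :: l) = pd i (listPd φ l) := fun l => by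
    funext x
    simp [listPd]
  induction l with
  | nil =>
    rw [Var.insert, key]
    exact fun _ _ => rfl
  | cons k l ih =>
    rw [Var.insert]
    cases Nat.ble (i + 1) k with
    | true =>
      rw [cond_true, key]
      exact fun _ _ => rfl
    | false =>
      rw [cond_false]
      intro x hx
      by_cases hk : k - 1 < n
      · have e : ∀ l, listPd φ (k :: l) = pd ⟨k - 1, hk⟩ (listPd φ l) := fun l => by
          funext x
          simp [listPd, hk]
        rw [e, e, pd_comm hU _ _ (contDiffOn_listPd hU h l) hx]
        exact pd_congr hU _ ih hx
      · have e : ∀ l, listPd φ (k :: l) = fun _ => 0 := fun l => by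
          funext x
          simp [listPd, hk]
        rw [e, e]
        exact pd_const i 0

end Iterated

/-! ### Jets of a function of two coordinates -/

section Admissible

variable {a : Fin 6} {U : Set (Pt 6)} {f : Pt 6 → ℝ}

theorem Admissible.mono {V : Set (Pt 6)} (h : Admissible a U f) (hV : IsOpen V) (hVU : V ⊆ U) :
    Admissible a V f :=
  ⟨hV, h.2.1.mono hVU, fun x hx y hy => h.2.2.1 x (hVU hx) y (hVU hy),
    fun x hx => h.2.2.2 x (hVU hx)⟩

/-- Moving in the direction `b` changes neither of the two relevant coordinates, so `f` is constant
along the line `c` as long as it stays in the open set. -/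
theorem Admissible.pd_eq_zero (h : Admissible a U f) {b : Fin 6} (hb : b ≠ a) (hb2 : b ≠ 2)
    {x : Pt 6} (hx : x ∈ U) : pd b f x = 0 := by
  have hd := differentiableAt_of_contDiffOn h.1 h.2.1 hx
  let c : ℝ → Pt 6 := fun s => x + s • Pi.single b 1
  have hc : HasDerivAt c (Pi.single b 1) 0 := by
    have := ((hasDerivAt_id (0 : ℝ)).smul_const (Pi.single b (1 : ℝ) : Pt 6)).const_add x
    rwa [one_smul] at this
  have hc0 : c 0 = x := by simp [c]
  have h1 : HasDerivAt (f ∘ c) (fderiv ℝ f x (Pi.single b 1)) 0 := by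
    refine HasFDerivAt.comp_hasDerivAt 0 ?_ hc
    rw [hc0]
    exact hd.hasFDerivAt
  have h2 : f ∘ c =ᶠ[nhds 0] fun _ => f x := by
    have hU : c ⁻¹' U ∈ nhds (0 : ℝ) :=
      hc.continuousAt.preimage_mem_nhds (hc0 ▸ h.1.mem_nhds hx)
    filter_upwards [hU] with s hs
    refine h.2.2.1 _ hs _ hx ?_ ?_
    · simp [c, hb.symm]
    · simp [c, hb2.symm]
  exact h1.unique ((hasDerivAt_const 0 (f x)).congr_of_eventuallyEq h2)

theorem Admissible.smooth_jet (h : Admissible a U f) (r s : ℕ) :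
    ContDiffOn ℝ ∞ (fun x => jet a f x (r, s)) U :=
  contDiffOn_iterate_pd h.1 a r (contDiffOn_iterate_pd h.1 2 s h.2.1)

theorem Admissible.pd_jet (h : Admissible a U f) (i : Fin 6) (r s : ℕ)
    {x : Pt 6} (hx : x ∈ U) : pd i (fun y => jet a f y (r, s)) x =
      if i = a then jet a f x (r + 1, s) else if i = 2 then jet a f x (r, s + 1) else 0 := by
  have hs := contDiffOn_iterate_pd h.1 2 s h.2.1
  have h0 : (fun y => jet a f y (r, s)) = (pd a)^[r] ((pd 2)^[s] f) := rfl
  rw [h0]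
  split_ifs with hi hi2
  · rw [hi, jet, Function.iterate_succ_apply']
  · rw [hi2, pd_iterate_pd h.1 a 2 r hs hx, jet, Function.iterate_succ_apply']
  · rw [pd_iterate_pd h.1 a i r hs hx,
      iterate_pd_congr h.1 a r (pd_iterate_pd h.1 2 i s h.2.1) hx]
    have h1 : Set.EqOn (pd i f) (fun _ => 0) U := fun y hy => h.pd_eq_zero hi hi2 hy
    rw [iterate_pd_congr h.1 a r (iterate_pd_congr h.1 2 s h1) hx, iterate_pd_zero,
      iterate_pd_zero]

end Admissible

/-- The values of the generators at a point `x` of `ℝ⁶`. -/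
noncomputable def varVal (a : Fin 6) (f : Pt 6 → ℝ) (t ϱ : ℝ) (π : List ℕ → ℝ) (e : ℝ) (x : Pt 6) :
    Var → ℝ
  | .coord 0 => t
  | .coord (j + 1) => if h : j < 6 then x ⟨j, h⟩ else if j = 6 then ϱ else 0
  | .jet r s => jet a f x (r, s)
  | .pot l => π l
  | .expo => e

section Base

variable {a : Fin 6} {U : Set (Pt 6)} {f : Pt 6 → ℝ}

theorem smooth_coord {n : ℕ} {U : Set (Pt n)} (j : Fin n) :
    ContDiffOn ℝ ∞ (fun x : Pt n => x j) U :=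
  (contDiff_apply ℝ ℝ j).contDiffOn

theorem smooth_varVal (h : Admissible a U f) (t ϱ : ℝ) {π : Pt 6 → List ℕ → ℝ} {e : Pt 6 → ℝ}
    (hπ : ∀ l, ContDiffOn ℝ ∞ (fun x => π x l) U) (he : ContDiffOn ℝ ∞ e U) (v : Var) :
    ContDiffOn ℝ ∞ (fun x => varVal a f t ϱ (π x) (e x) x v) U := by
  cases v with
  | coord j =>
    cases j with
    | zero => exact contDiffOn_const
    | succ j =>
      simp only [varVal]
      split_ifs
      · exact smooth_coord _
      · exact contDiffOn_const
      · exact contDiffOn_const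
  | jet r s => exact h.smooth_jet r s
  | pot l => exact hπ l
  | expo => exact he

theorem pd_varVal_coord (t ϱ : ℝ) {π : Pt 6 → List ℕ → ℝ} {e : Pt 6 → ℝ} (i : Fin 6) (j : ℕ)
    (x : Pt 6) : pd i (fun y => varVal a f t ϱ (π y) (e y) y (.coord j)) x =
      if (i : ℕ) + 1 = j then 1 else 0 := by
  cases j with
  | zero => simp [varVal, pd_const]
  | succ j =>
    unfold varVal
    by_cases h : j < 6
    · simp only [h, dite_true, pd_coord, Fin.ext_iff, add_left_inj]
    · have h1 : (i : ℕ) + 1 ≠ j + 1 := by have := i.2; omega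
      simp only [h, dite_false, pd_const, h1, if_false]

theorem pd_varVal_jet (h : Admissible a U f) (t ϱ : ℝ) {π : Pt 6 → List ℕ → ℝ} {e : Pt 6 → ℝ}
    (i : Fin 6) (r s : ℕ) {x : Pt 6} (hx : x ∈ U) :
    pd i (fun y => varVal a f t ϱ (π y) (e y) y (.jet r s)) x =
      if (i : ℕ) + 1 = a + 1 then jet a f x (r + 1, s)
      else if (i : ℕ) + 1 = 3 then jet a f x (r, s + 1) else 0 := by
  have h3 : (i : ℕ) + 1 = 3 ↔ i = 2 := by
    rw [Fin.ext_iff]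
    exact ⟨fun h => Nat.succ.inj h, fun h => congrArg Nat.succ h⟩
  simp only [h3, add_left_inj, ← Fin.ext_iff]
  exact h.pd_jet i r s hx

/-- The generators foreign to the base are frozen at arbitrary constants. Fractions for tensors on
the base thus remain valid for every choice of these constants, which later carries them over to the
ambient space and to rescaled metrics. -/
theorem isModel_base (h : Admissible a U f) (t ϱ : ℝ) (π : List ℕ → ℝ) (e : ℝ) :
    IsModel U (fun x => Var.env (varVal a f t ϱ π e x)) Var.top
      (fun i => Var.diffList false (a + 1) (i + 1)) := by
  refine Var.isModel h.1 false (a + 1) 1 (by simp) _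
    (smooth_varVal h t ϱ (fun _ => contDiffOn_const) contDiffOn_const) fun i v x hx => ?_
  cases v with
  | coord j => exact pd_varVal_coord (π := fun _ => π) (e := fun _ => e) t ϱ i j x
  | jet r s => exact pd_varVal_jet (π := fun _ => π) (e := fun _ => e) h t ϱ i r s hx
  | pot l => exact pd_const i _
  | expo => exact pd_const i _

theorem isModel_conformal (h : Admissible a U f) {φ : Pt 6 → ℝ} (hφ : ContDiffOn ℝ ∞ φ U) :
    IsModel U
      (fun x => Var.env (varVal a f 1 0 (fun l => listPd φ l x) (Real.exp (2 * φ x)) x)) Var.top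
      (fun i => Var.diffList true (a + 1) (i + 1)) := by
  have he : ContDiffOn ℝ ∞ (fun x => Real.exp (2 * φ x)) U :=
    Real.contDiff_exp.comp_contDiffOn (contDiffOn_const.mul hφ)
  refine Var.isModel h.1 true (a + 1) 1 (by simp) _
    (smooth_varVal h 1 0 (fun l => contDiffOn_listPd h.1 hφ l) he) fun i v x hx => ?_
  cases v with
  | coord j =>
    exact pd_varVal_coord (π := fun y l => listPd φ l y) (e := fun y => Real.exp (2 * φ y))
      1 0 i j x
  | jet r s =>
    exact pd_varVal_jet (π := fun y l => listPd φ l y) (e := fun y => Real.exp (2 * φ y))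
      h 1 0 i r s
      hx
  | pot l => exact pd_listPd h.1 hφ i l hx
  | expo =>
    have hd := differentiableAt_of_contDiffOn h.1 hφ hx
    have h1 : pd i (fun y => Real.exp (2 * φ y)) x = 2 * (pd i φ x * Real.exp (2 * φ x)) := by
      have h2 := (hd.const_mul 2).hasFDerivAt.exp
      rw [pd, h2.fderiv, fderiv_const_mul hd]
      simp only [smul_apply, smul_eq_mul, pd]
      ring
    refine h1.trans ?_
    simp [Var.diffVal, varVal, listPd]

end Base

/-! ### Generators on the ambient space -/

section AmbientSpace

variable {n : ℕ}

/-- The projection to the base. -/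
def basePtL (n : ℕ) : Pt (n + 2) →L[ℝ] Pt n :=
  ContinuousLinearMap.pi fun i => ContinuousLinearMap.proj (baseIdx i)

theorem isOpen_ambientSpace {U : Set (Pt n)} (hU : IsOpen U) (ε : ℝ) :
    IsOpen (ambientSpace U ε) := by
  have h1 : IsOpen {X : Pt (n + 2) | 0 < X 0} :=
    isOpen_lt continuous_const (continuous_apply 0)
  have h2 : IsOpen {X : Pt (n + 2) | |X (Fin.last (n + 1))| < ε} :=
    isOpen_lt (continuous_apply _).abs continuous_const
  exact h1.inter ((hU.preimage (basePtL n).continuous).inter h2)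

theorem baseIdx_or (i : Fin (n + 2)) :
    i = 0 ∨ i = Fin.last (n + 1) ∨ ∃ k : Fin n, i = baseIdx k := by
  induction i using Fin.lastCases with
  | last => exact Or.inr (Or.inl rfl)
  | cast i =>
    induction i using Fin.cases with
    | zero => exact Or.inl rfl
    | succ k => exact Or.inr (Or.inr ⟨k, rfl⟩)

theorem val_baseIdx (k : Fin n) : (baseIdx k : ℕ) = k + 1 := rfl

theorem pd_comp_basePt {ψ : Pt n → ℝ} (i : Fin (n + 2)) (X : Pt (n + 2))
    (h : DifferentiableAt ℝ ψ (basePt X)) :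
    pd i (fun Y => ψ (basePt Y)) X = fderiv ℝ ψ (basePt X) (basePt (Pi.single i 1)) := by
  have h1 : HasFDerivAt (fun Y => ψ (basePt Y)) ((fderiv ℝ ψ (basePt X)).comp (basePtL n)) X :=
    HasFDerivAt.comp (g := ψ) X h.hasFDerivAt (basePtL n).hasFDerivAt
  rw [pd, h1.fderiv]
  rfl

theorem basePt_single_baseIdx (k : Fin n) :
    basePt (Pi.single (baseIdx k) (1 : ℝ)) = Pi.single k 1 := by
  funext j
  simp only [basePt, Pi.single_apply, Fin.ext_iff, val_baseIdx, add_left_inj]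

theorem basePt_single_eq_zero {i : Fin (n + 2)} (h : ∀ k : Fin n, baseIdx k ≠ i) :
    basePt (Pi.single i (1 : ℝ)) = 0 := by
  funext j
  simp [basePt, h]

variable {a : Fin 6} {U : Set (Pt 6)} {f : Pt 6 → ℝ}

/-- The values of the generators at a point of the ambient space. -/
noncomputable def ambientVal (a : Fin 6) (f : Pt 6 → ℝ) (X : Pt (6 + 2)) : Var → ℝ :=
  varVal a f (X 0) (X (Fin.last 7)) (fun _ => 0) 1 (basePt X)

theorem isModel_ambient (h : Admissible a U f) (ε : ℝ) :
    IsModel (ambientSpace U ε) (fun X => Var.env (ambientVal a f X)) Var.top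
      (fun i => Var.diffList false (a + 1) (i + 0)) := by
  have hcoord : ∀ j : ℕ, (fun X => ambientVal a f X (.coord j)) =
      fun X => if h : j < 8 then X ⟨j, h⟩ else 0 := by
    intro j
    funext X
    unfold ambientVal
    cases j with
    | zero => rfl
    | succ j =>
      unfold varVal
      by_cases h1 : j < 6
      · have h2 : j + 1 < 8 := by omega
        simp only [h1, h2, dite_true]
        rfl
      · by_cases h3 : j = 6
        · subst h3; rfl
        · have h2 : ¬ j + 1 < 8 := by omega
          simp only [h1, h2, h3, dite_false, if_false]
  refine Var.isModel (isOpen_ambientSpace h.1 ε) false (a + 1) 0 (by simp) _ (fun v => ?_)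
    fun i v X hX => ?_
  · cases v with
    | coord j =>
      rw [hcoord]
      split_ifs
      · exact smooth_coord _
      · exact contDiffOn_const
    | jet r s =>
      exact (h.smooth_jet r s).comp (basePtL 6).contDiff.contDiffOn fun X hX => hX.2.1
    | pot l => exact contDiffOn_const
    | expo => exact contDiffOn_const
  · cases v with
    | coord j =>
      rw [hcoord, Var.diffVal]
      by_cases h1 : j < 8
      · simp only [h1, dite_true, pd_coord, Fin.ext_iff, add_zero]
      · have h2 : (i : ℕ) + 0 ≠ j := by have := i.2; omega
        simp only [h1, dite_false, pd_const, h2, if_false]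
    | jet r s =>
      have hd := differentiableAt_of_contDiffOn h.1 (h.smooth_jet r s) hX.2.1
      refine (pd_comp_basePt (ψ := fun x => jet a f x (r, s)) i X hd).trans ?_
      rcases baseIdx_or i with rfl | rfl | ⟨k, rfl⟩
      · rw [basePt_single_eq_zero fun k hk => ?_, map_zero]
        · rfl
        · exact absurd (congrArg Fin.val hk) (by simp [val_baseIdx])
      · rw [basePt_single_eq_zero fun k hk => ?_, map_zero]
        · have h1 : (7 : ℕ) ≠ a + 1 := by have := a.2; omega
          simp [Var.diffVal, h1]
        · have h1 := congrArg Fin.val hk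
          rw [val_baseIdx, Fin.val_last] at h1
          have := k.2
          omega
      · rw [basePt_single_baseIdx]
        exact pd_varVal_jet (π := fun _ _ => 0) (e := fun _ => 1) h (X 0) (X (Fin.last 7)) k r s
          hX.2.1
    | pot l => exact pd_const i _
    | expo => exact pd_const i _

end AmbientSpace

/-! ### The tables of the metrics -/

namespace Table

open Frac

/-- The generator `v`. -/
def var (v : Var) : Frac := gen (Var.code v)

/-- The rational number `z / c`. -/
noncomputable def rat (z : ℤ) (c : ℕ) : Frac := mul (int z) (inv c 1)

section Bryant

variable (a : ℕ)

/-- The derivations of the base; `a` is the name of a coordinate. -/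
noncomputable abbrev baseDir : ℕ → Frac → Frac := dir fun i => Var.diffList false a (i + 1)

/-- The function `f`. -/
def f₀ : Frac := var (.jet 0 0)

/-- The derivative `fᵢ`. -/
noncomputable def f₁ (i : ℕ) : Frac := baseDir a i f₀

/-- The derivative `fⱼᵢ`. -/
noncomputable def f₂ (i j : ℕ) : Frac := baseDir a i (f₁ a j)

noncomputable def θ₁ (j : ℕ) : Frac := add (delta 3 j) (mul (var (.coord 2)) (delta 2 j))

noncomputable def θ₂ (j : ℕ) : Frac := add (delta 4 j) (mul f₀ (delta 0 j))

noncomputable def θ₃ (j : ℕ) : Frac := add (delta 5 j) (mul (var (.coord 1)) (delta 1 j))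

/-- The coefficient `(3/2) f₃²`. -/
noncomputable def coeff₀ : Frac := mul (rat 3 2) (mul (f₁ a 2) (f₁ a 2))

/-- The coefficient `(1/2) f₁₃`. -/
noncomputable def coeff₁ : Frac := mul (rat 1 2) (f₂ a 0 2)

/-- The coefficient `(3/2) f₃ f₂`. -/
noncomputable def coeff₂ : Frac := mul (mul (rat 3 2) (f₁ a 2)) (f₁ a 1)

/-- The coefficient `(1/2) (f₃ f₂₃ - f₂ f₃₃)`. -/
noncomputable def coeff₃ : Frac :=
  mul (rat 1 2) (sub (mul (f₁ a 2) (f₂ a 1 2)) (mul (f₁ a 1) (f₂ a 2 2)))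

/-- The coefficient `(1/2) (f₂ f₁₃ - f₃ f₁₂)`. -/
noncomputable def coeff₄ : Frac :=
  mul (rat 1 2) (sub (mul (f₁ a 1) (f₂ a 0 2)) (mul (f₁ a 2) (f₂ a 0 1)))

noncomputable def θ₄ (j : ℕ) : Frac := mul (coeff₀ a) (delta 0 j)

noncomputable def θ₅ (j : ℕ) : Frac :=
  sub (mul (mul (rat 3 2) (f₁ a 2)) (delta 1 j)) (mul (mul (rat 1 2) (f₂ a 2 2)) (θ₁ j))

noncomputable def θ₆ (j : ℕ) : Frac :=
  add (add (add (add (mul (coeff₀ a) (delta 2 j)) (mul (coeff₁ a) (θ₂ j)))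
    (mul (coeff₂ a) (delta 1 j))) (mul (coeff₃ a) (θ₁ j))) (mul (coeff₄ a) (θ₃ j))

noncomputable def symProd (α β : ℕ → Frac) (i j : ℕ) : Frac :=
  add (mul (α i) (β j)) (mul (β i) (α j))

noncomputable def metric (i j : ℕ) : Frac :=
  add (add (symProd θ₁ (θ₄ a) i j) (symProd θ₂ (θ₅ a) i j)) (symProd θ₃ (θ₆ a) i j)

/-- The coefficients of `dx¹` with respect to `θ¹, …, θ⁶`. -/
noncomputable def coframe₁ (k : ℕ) : Frac :=
  mul (mul (int 2) (inv 3 (Nat.mul (Var.code (.jet 0 1)) (Var.code (.jet 0 1))))) (delta 3 k)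

/-- The coefficients of `dx²` with respect to `θ¹, …, θ⁶`. -/
noncomputable def coframe₂ (k : ℕ) : Frac :=
  mul (mul (int 2) (inv 3 (Var.code (.jet 0 1))))
    (add (delta 4 k) (mul (mul (rat 1 2) (f₂ a 2 2)) (delta 0 k)))

/-- The coefficients of `dx³` with respect to `θ¹, …, θ⁶`. -/
noncomputable def coframe₃ (k : ℕ) : Frac :=
  mul (mul (int 2) (inv 3 (Nat.mul (Var.code (.jet 0 1)) (Var.code (.jet 0 1)))))
    (sub (sub (sub (sub (delta 5 k) (mul (coeff₁ a) (delta 1 k))) (mul (coeff₂ a) (coframe₂ a k)))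
      (mul (coeff₃ a) (delta 0 k))) (mul (coeff₄ a) (delta 2 k)))

/-- The coefficients of the coordinate covectors with respect to `θ¹, …, θ⁶`. -/
noncomputable def coframe (i k : ℕ) : Frac :=
  match i with
  | 0 => coframe₁ k
  | 1 => coframe₂ a k
  | 2 => coframe₃ a k
  | 3 => sub (delta 0 k) (mul (var (.coord 2)) (coframe₃ a k))
  | 4 => sub (delta 1 k) (mul f₀ (coframe₁ k))
  | _ => sub (delta 2 k) (mul (var (.coord 1)) (coframe₂ a k))

/-- The inverse of the metric. -/
noncomputable def metricInv (i j : ℕ) : Frac :=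
  sumTo 3 fun k => symProd (fun l => coframe a l k) (fun l => coframe a l (k + 3)) i j

/-- The metric `e^{2φ} g`. -/
noncomputable def conformal (i j : ℕ) : Frac := mul (var .expo) (metric a i j)

/-- The inverse of the metric `e^{2φ} g`. -/
noncomputable def conformalInv (i j : ℕ) : Frac :=
  mul (inv 1 (Var.code .expo)) (metricInv a i j)

/-- The Schouten tensor of the metric. -/
noncomputable def baseSchouten : ℕ → ℕ → Frac :=
  schouten 6 (baseDir a) (metric a) (metricInv a)

/-- `2 ϱ`. -/
noncomputable def twoRho : Frac := mul (int 2) (var (.coord 7))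

/-- The ambient metric. -/
noncomputable def ambient (i j : ℕ) : Frac :=
  add (symProd (fun k => add (mul (var (.coord 7)) (delta 0 k)) (mul (var (.coord 0)) (delta 7 k)))
      (delta 0) i j)
    (mul (mul (var (.coord 0)) (var (.coord 0))) (sumTo 6 fun k => sumTo 6 fun l =>
      mul (mul (add (metric a k l) (mul twoRho (baseSchouten a k l))) (delta (k + 1) i))
        (delta (l + 1) j)))

/-- The inverse of the ambient metric. -/
noncomputable def ambientInv (i j : ℕ) : Frac :=
  add (mul (inv 1 (Var.code (.coord 0)))
      (add (mul (delta 0 i) (delta 7 j)) (mul (delta 7 i) (delta 0 j))))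
    (mul (inv 1 (Nat.mul (Var.code (.coord 0)) (Var.code (.coord 0))))
      (sub (sumTo 6 fun k => sumTo 6 fun l =>
          mul (mul (sub (metricInv a k l)
            (mul twoRho (raiseBoth 6 (metricInv a) (baseSchouten a) k l))) (delta (k + 1) i))
            (delta (l + 1) j))
        (mul twoRho (mul (delta 7 i) (delta 7 j)))))

end Bryant

/-- The product of the invertible generators. -/
def unit : ℕ :=
  Nat.mul (Var.code (.jet 0 1)) (Nat.mul (Var.code (.coord 0)) (Var.code .expo))

/-- The derivatives of `f` that occur in the metric can be differentiated. -/
noncomputable def levelCheck (a : ℕ) : Bool :=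
  lev Var.top f₀ && ((f₁ a 2).lev Var.top && ((f₁ a 1).lev Var.top))

end Table

/-! ### The metric of `f` and its table -/

section Representation

variable {a : Fin 6} {U : Set (Pt 6)} {f : Pt 6 → ℝ}

/-- Only `f₃`, `t` and `exp (2 φ)` are inverted: `f₃` is nonzero by admissibility, and the other two
by hypothesis on their values. -/
theorem mval_unit (h : Admissible a U f) {t ϱ e : ℝ} (π : List ℕ → ℝ) (ht : t ≠ 0) (he : e ≠ 0)
    {x : Pt 6} (hx : x ∈ U) : mval (Var.env (varVal a f t ϱ π e x)) Table.unit ≠ 0 := by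
  have e1 : Table.unit = Var.code (.jet 0 1) * (Var.code (.coord 0) * Var.code .expo) := rfl
  rw [e1, mval_mul, mval_mul, Var.mval_code _ (by decide +kernel),
    Var.mval_code _ (by decide +kernel), Var.mval_code _ (by decide +kernel)]
  exact mul_ne_zero (h.2.2.2 x hx) (mul_ne_zero ht he)

section General

variable {n : ℕ} {V : Set (Pt n)} {w : Pt n → Var → ℝ}

theorem rep_var {v : Var} (hv : v ∈ Var.all) :
    Rep V (fun x => Var.env (w x)) (fun x => w x v) (Table.var v) := fun x _ => by
  have := Frac.val_gen (ρ := Var.env (w x)) (Var.code v)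
  rwa [Var.mval_code _ hv] at this

theorem rep_rat {env : Pt n → ℕ → ℝ} (z : ℤ) {c : ℕ} (hc : c ≠ 0) :
    Rep V env (fun _ => (z : ℝ) / c) (Table.rat z c) :=
  ((Rep.int z).mul (Rep.inv hc)).congr fun _ _ => div_eq_mul_one_div _ _

theorem rep_dx {n' : ℕ} {env : Pt n → ℕ → ℝ} (i j : Fin n') :
    Rep V env (fun _ => dx i j) (Table.delta i j) := by
  have h : ∀ x : Pt n, Frac.Val (env x) ((1 : Matrix (Fin n') (Fin n') ℝ) i j) (Table.delta i j) :=
    fun x => Rep.delta (U := (Set.univ : Set (Pt n'))) (env := fun _ => env x) i j 0 trivial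
  intro x _
  have e : dx i j = (1 : Matrix (Fin n') (Fin n') ℝ) i j := by
    rw [dx, Pi.single_apply, Matrix.one_apply]
    simp only [eq_comm]
  rw [e]
  exact h x

end General

section Metric

variable (h : Admissible a U f) (t ϱ : ℝ) (π : List ℕ → ℝ) (e : ℝ)
  (hl : Table.levelCheck (a + 1) = true)
include h hl

theorem rep_metric (i j : Fin 6) :
    Rep U (fun x => Var.env (varVal a f t ϱ π e x)) (fun x => bryantMetric f x i j)
      (Table.metric (a + 1) i j) := by
  set env := fun x => Var.env (varVal a f t ϱ π e x) with henv
  have hM := isModel_base h t ϱ π e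
  simp only [Table.levelCheck, Bool.and_eq_true] at hl
  have hf : Rep U env f Table.f₀ := rep_var (v := .jet 0 0) (by decide +kernel)
  have hx0 : Rep U env (fun x => x 0) (Table.var (.coord 1)) :=
    rep_var (v := .coord 1) (by decide +kernel)
  have hx1 : Rep U env (fun x => x 1) (Table.var (.coord 2)) :=
    rep_var (v := .coord 2) (by decide +kernel)
  have hf1 : ∀ i : Fin 6, Rep U env (pd i f) (Table.f₁ (a + 1) i) := fun i => hf.pd hM i hl.1
  have hf2 : ∀ i j : Fin 6, (Table.f₁ (a + 1) j).lev Var.top = true →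
      Rep U env (pd i (pd j f)) (Table.f₂ (a + 1) i j) := fun i j hj => (hf1 j).pd hM i hj
  have hf22 := fun i : Fin 6 => hf2 i 2 hl.2.1
  have hf21 := fun i : Fin 6 => hf2 i 1 hl.2.2
  have h32 : Rep U env (fun _ => (3 / 2 : ℝ)) (Table.rat 3 2) := by
    have := rep_rat (V := U) (env := env) 3 two_ne_zero
    simpa using this
  have h12 : Rep U env (fun _ => (1 / 2 : ℝ)) (Table.rat 1 2) := by
    have := rep_rat (V := U) (env := env) 1 two_ne_zero
    simpa using this
  have hdx : ∀ i j : Fin 6, Rep U env (fun _ => dx i j) (Table.delta i j) := fun i j => rep_dx i j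
  have hc0 : Rep U env (fun x => 3 / 2 * pd 2 f x ^ 2) (Table.coeff₀ (a + 1)) :=
    (h32.mul ((hf1 2).mul (hf1 2))).congr fun x _ => by rw [pow_two]
  have hc1 : Rep U env (fun x => 1 / 2 * pd 0 (pd 2 f) x) (Table.coeff₁ (a + 1)) :=
    h12.mul (hf22 0)
  have hc2 : Rep U env (fun x => 3 / 2 * pd 2 f x * pd 1 f x) (Table.coeff₂ (a + 1)) :=
    (h32.mul (hf1 2)).mul (hf1 1)
  have hc3 : Rep U env
      (fun x => 1 / 2 * (pd 2 f x * pd 1 (pd 2 f) x - pd 1 f x * pd 2 (pd 2 f) x))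
      (Table.coeff₃ (a + 1)) :=
    h12.mul (((hf1 2).mul (hf22 1)).sub ((hf1 1).mul (hf22 2)))
  have hc4 : Rep U env
      (fun x => 1 / 2 * (pd 1 f x * pd 0 (pd 2 f) x - pd 2 f x * pd 0 (pd 1 f) x))
      (Table.coeff₄ (a + 1)) :=
    h12.mul (((hf1 1).mul (hf22 0)).sub ((hf1 2).mul (hf21 0)))
  have h1 : ∀ j : Fin 6, Rep U env (fun x => θ₁ x j) (Table.θ₁ j) :=
    fun j => (hdx 3 j).add (hx1.mul (hdx 2 j))
  have h2 : ∀ j : Fin 6, Rep U env (fun x => θ₂ f x j) (Table.θ₂ j) :=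
    fun j => (hdx 4 j).add (hf.mul (hdx 0 j))
  have h3 : ∀ j : Fin 6, Rep U env (fun x => θ₃ x j) (Table.θ₃ j) :=
    fun j => (hdx 5 j).add (hx0.mul (hdx 1 j))
  have h4 : ∀ j : Fin 6, Rep U env (fun x => θ₄ f x j) (Table.θ₄ (a + 1) j) :=
    fun j => hc0.mul (hdx 0 j)
  have h5 : ∀ j : Fin 6, Rep U env (fun x => θ₅ f x j) (Table.θ₅ (a + 1) j) :=
    fun j => ((h32.mul (hf1 2)).mul (hdx 1 j)).sub ((h12.mul (hf22 2)).mul (h1 j))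
  have h6 : ∀ j : Fin 6, Rep U env (fun x => θ₆ f x j) (Table.θ₆ (a + 1) j) :=
    fun j => ((((hc0.mul (hdx 2 j)).add (hc1.mul (h2 j))).add (hc2.mul (hdx 1 j))).add
      (hc3.mul (h1 j))).add (hc4.mul (h3 j))
  exact ((((h1 i).mul (h4 j)).add ((h4 i).mul (h1 j))).add
    (((h2 i).mul (h5 j)).add ((h5 i).mul (h2 j)))).add
    (((h3 i).mul (h6 j)).add ((h6 i).mul (h3 j)))

variable (ht : t ≠ 0) (he : e ≠ 0)
  (hi : Table.inverse 6 (Table.metric (a + 1)) (Table.metricInv (a + 1)) Table.unit = true)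
include ht he hi

theorem repMetric_base :
    RepMetric U (fun x => Var.env (varVal a f t ϱ π e x)) Var.top
      (fun i => Var.diffList false (a + 1) (i + 1)) (bryantMetric f)
      (Table.metric (a + 1)) (Table.metricInv (a + 1)) :=
  repMetric_of_table (isModel_base h t ϱ π e) (rep_metric h t ϱ π e hl)
    (fun _ hx => mval_unit h π ht he hx) hi

end Metric

end Representation

/-! ### The computations -/

namespace Table

open Frac

/-- The computations for the metric of `f`, a function of the coordinates with the names `a`
and `3`. -/
noncomputable def baseCheck (a : ℕ) : Bool :=
  let D := baseDir a
  let g := metric a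
  let gi := metricInv a
  lev2 6 Var.top g && (inverse 6 g gi unit &&
  (christoffelCheck 6 D g gi Var.top && (lev2 6 Var.top (schouten 6 D g gi) &&
  (lev3 6 Var.top (cotton 6 D g gi) && (zero2 6 (bach 6 D g gi) &&
  (zero2 6 (schoutenSq 6 D g gi) && ((trSchouten 6 D g gi).isZero &&
  (zero2 6 (schoutenSqUp 6 D g gi) && (zero2 6 (schoutenNablaCotton 6 D g gi) &&
  (zero2 6 (cottonSq₁ 6 D g gi) && zero2 6 (cottonSq₂ 6 D g gi)))))))))))

/-- The computations for the ambient metric. -/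
noncomputable def ambientCheck (a : ℕ) : Bool :=
  let D := dir fun i => Var.diffList false a (i + 0)
  let g := ambient a
  let gi := ambientInv a
  lev2 8 Var.top g && (inverse 8 g gi unit && (christoffelCheck 8 D g gi Var.top &&
  zero2 8 (ricci 8 D g gi)))

/-- The derivations for a conformal factor. -/
noncomputable abbrev conformalDir (a : ℕ) : ℕ → Frac → Frac :=
  dir fun i => Var.diffList true a (i + 1)

/-- The computations for the metric `e^{2φ} g`: the component of its Cotton tensor with the indices
`i`, `j` and `k` is `F`. -/
noncomputable def conformalCheck (a i j k : ℕ) (F : Frac) : Bool :=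
  let D := conformalDir a
  let g := conformal a
  let gi := conformalInv a
  lev2 6 Var.top g && (inverse 6 g gi unit && (christoffelCheck 6 D g gi Var.top &&
  ((schouten 6 D g gi i j).lev Var.top && ((schouten 6 D g gi i k).lev Var.top &&
  (sub (cotton 6 D g gi i j k) F).isZero))))

end Table

/-! ### Polynomials in the jet of `f` -/

/-- A polynomial in the jet coordinates, given by its terms: the coefficients, and the lists of the
variables in the monomials. -/
abbrev JetPoly := List (ℤ × List (ℕ × ℕ))

namespace JetPoly

/-- The polynomial. -/
noncomputable def toMvPolynomial (l : JetPoly) : MvPolynomial (ℕ × ℕ) ℝ :=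
  (l.map fun t => MvPolynomial.C (t.1 : ℝ) * (t.2.map MvPolynomial.X).prod).sum

/-- The polynomial as a fraction. -/
noncomputable def toFrac (l : JetPoly) : Frac :=
  l.foldr (fun t F => Frac.add (Frac.mul (Frac.int t.1)
    (t.2.foldr (fun m G => Frac.mul (Table.var (.jet m.1 m.2)) G) (Frac.int 1))) F) Frac.zero

/-- The variables are among the generators. -/
def isValid (l : JetPoly) : Bool :=
  l.all fun t => t.2.all fun m => decide (Var.jet m.1 m.2 ∈ Var.all)

theorem val_toFrac {w : Var → ℝ} {J : ℕ × ℕ → ℝ} (hw : ∀ m, w (.jet m.1 m.2) = J m) (l : JetPoly)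
    (hl : l.isValid = true) :
    (toFrac l).Val (Var.env w) (MvPolynomial.eval J l.toMvPolynomial) := by
  induction l with
  | nil => simpa [toFrac, toMvPolynomial] using Frac.val_zero
  | cons t l ih =>
    rw [isValid, List.all_cons, Bool.and_eq_true] at hl
    have h1 : ∀ s : List (ℕ × ℕ), (s.all fun m => decide (Var.jet m.1 m.2 ∈ Var.all)) = true →
        Frac.Val (Var.env w) (MvPolynomial.eval J (s.map MvPolynomial.X).prod)
          (s.foldr (fun m G => Frac.mul (Table.var (.jet m.1 m.2)) G) (Frac.int 1)) := by
      intro s hs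
      induction s with
      | nil => simpa using Frac.val_int (ρ := Var.env w) 1
      | cons m s ihs =>
        rw [List.all_cons, Bool.and_eq_true] at hs
        rw [List.map_cons, List.prod_cons, map_mul, MvPolynomial.eval_X, List.foldr_cons, ← hw]
        have h2 := rep_var (V := (Set.univ : Set (Pt 0))) (w := fun _ => w)
          (of_decide_eq_true hs.1) 0 trivial
        exact h2.mul (ihs hs.2)
    have h3 := ((Frac.val_int (ρ := Var.env w) t.1).mul (h1 t.2 hl.1)).add (ih hl.2)
    rw [toMvPolynomial, List.map_cons, List.sum_cons, map_add, map_mul, MvPolynomial.eval_C]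
    exact h3

end JetPoly

/-- A multiple of a component of the Cotton tensor for functions of `x¹` and `x³`. -/
def cottonPoly₁ : JetPoly :=
  [(20, [(0, 2), (0, 3), (1, 1), (1, 1)]), (-40, [(0, 2), (0, 2), (1, 1), (1, 2)]),
    (20, [(0, 2), (0, 2), (0, 2), (2, 1)]), (-20, [(0, 1), (0, 2), (0, 3), (2, 1)]),
    (8, [(0, 1), (0, 2), (1, 1), (1, 3)]), (20, [(0, 1), (0, 2), (1, 2), (1, 2)]),
    (-4, [(0, 1), (0, 2), (0, 2), (2, 2)]), (-4, [(0, 1), (0, 4), (1, 1), (1, 1)]),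
    (3, [(0, 1), (0, 1), (0, 3), (2, 2)]), (3, [(0, 1), (0, 1), (0, 4), (2, 1)]),
    (-6, [(0, 1), (0, 1), (1, 2), (1, 3)])]

/-- A multiple of a component of the Cotton tensor for functions of `x²` and `x³`. -/
def cottonPoly₂ : JetPoly :=
  [(20, [(0, 2), (0, 2), (0, 2), (1, 1), (1, 1)]), (-20, [(0, 2), (0, 2), (0, 2), (0, 2), (2, 0)]),
    (-4, [(0, 1), (0, 2), (0, 3), (1, 1), (1, 1)]), (24, [(0, 1), (0, 2), (0, 2), (0, 3), (2, 0)]),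
    (-40, [(0, 1), (0, 2), (0, 2), (1, 1), (1, 2)]), (20, [(0, 1), (0, 2), (0, 2), (0, 2), (2, 1)]),
    (-19, [(0, 1), (0, 1), (0, 2), (0, 3), (2, 1)]), (-3, [(0, 1), (0, 1), (0, 2), (0, 4), (2, 0)]),
    (10, [(0, 1), (0, 1), (0, 2), (1, 1), (1, 3)]), (16, [(0, 1), (0, 1), (0, 2), (1, 2), (1, 2)]),
    (-5, [(0, 1), (0, 1), (0, 2), (0, 2), (2, 2)]), (6, [(0, 1), (0, 1), (0, 3), (1, 1), (1, 2)]),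
    (-3, [(0, 1), (0, 1), (0, 3), (0, 3), (2, 0)]), (-2, [(0, 1), (0, 1), (0, 4), (1, 1), (1, 1)]),
    (3, [(0, 1), (0, 1), (0, 1), (0, 3), (2, 2)]), (3, [(0, 1), (0, 1), (0, 1), (0, 4), (2, 1)]),
    (-6, [(0, 1), (0, 1), (0, 1), (1, 2), (1, 3)])]

namespace Table

open Frac

/-- The inverse of `108 f₃ ^ k`. -/
noncomputable def cottonFactor (k : ℕ) : Frac := inv 108 (Nat.pow (Var.code (.jet 0 1)) k)

theorem level_one : levelCheck 1 = true := by decide +kernel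

theorem level_two : levelCheck 2 = true := by decide +kernel

theorem base_one : baseCheck 1 = true := by decide +kernel

theorem base_two : baseCheck 2 = true := by decide +kernel

theorem ambient_one : ambientCheck 1 = true := by decide +kernel

theorem ambient_two : ambientCheck 2 = true := by decide +kernel

/-- This is the component in the directions `y²`, `y²`, `x³`. Neither `exp (2 φ)` nor a derivative
of `φ` occurs in the expected value, so the component is the same for all metrics in the conformal
class. -/
theorem conformal_one :
    conformalCheck 1 4 4 2 (mul (cottonFactor 6) (cottonPoly₁.toFrac)) = true := by
  decide +kernel

/-- For functions of `x²` and `x³` the component in the directions `y¹`, `y¹`, `x³` is the one that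
does not depend on `φ`. -/
theorem conformal_two :
    conformalCheck 2 3 3 2 (mul (cottonFactor 5) (cottonPoly₂.toFrac)) = true := by
  decide +kernel

end Table

/-! ### Einstein metrics have vanishing Cotton tensor -/

section Einstein

variable {n : ℕ} {U : Set (Pt n)} {g : Pt n → Mat n}

theorem IsMetricOn.isUnit_det (hg : IsMetricOn U g) {x : Pt n} (hx : x ∈ U) :
    IsUnit (g x).det := isUnit_iff_ne_zero.mpr (hg.2 x hx).2

/-- Lowering the upper index cancels the inverse metric and leaves the Christoffel symbols of the
first kind; two of these add up to a derivative of `g`. -/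
theorem sum_metric_mul_christoffel (hg : IsMetricOn U g) {x : Pt n} (hx : x ∈ U) (i j k : Fin n) :
    ∑ m, g x j m * christoffel g m k i x = (1 / 2) *
      (pd k (fun y => g y i j) x + pd i (fun y => g y k j) x - pd j (fun y => g y k i) x) := by
  have h1 := Matrix.mul_nonsing_inv (g x) (hg.isUnit_det hx)
  set A : Fin n → ℝ := fun l =>
    pd k (fun y => g y i l) x + pd i (fun y => g y k l) x - pd l (fun y => g y k i) x
  calc ∑ m, g x j m * christoffel g m k i x
      = (1 / 2) * ((g x * (g x)⁻¹).mulVec A) j := by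
        rw [← Matrix.mulVec_mulVec, Matrix.mulVec, dotProduct, Finset.mul_sum]
        refine Finset.sum_congr rfl fun m _ => ?_
        rw [christoffel, Matrix.mulVec, dotProduct]
        ring
    _ = (1 / 2) * A j := by rw [h1, Matrix.one_mulVec]

/-- The Levi-Civita connection is metric. -/
theorem nabla2_metric (hU : IsOpen U) (hg : IsMetricOn U g) {x : Pt n} (hx : x ∈ U)
    (k i j : Fin n) : nabla2 g g x k i j = 0 := by
  have hs : ∀ i j : Fin n, g x i j = g x j i := fun i j => (hg.2 x hx).1.apply j i
  have h1 := sum_metric_mul_christoffel hg hx i j k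
  have h2 := sum_metric_mul_christoffel hg hx j i k
  have hd : ∀ m i j, pd m (fun y => g y i j) x = pd m (fun y => g y j i) x := fun m i j =>
    pd_congr hU m (fun y hy => (hg.2 y hy).1.apply j i) hx
  have h3 : ∑ m, christoffel g m k i x * g x m j = ∑ m, g x j m * christoffel g m k i x :=
    Finset.sum_congr rfl fun m _ => by rw [hs m j, mul_comm]
  have h4 : ∑ m, christoffel g m k j x * g x i m = ∑ m, g x i m * christoffel g m k j x :=
    Finset.sum_congr rfl fun m _ => mul_comm _ _
  rw [nabla2, h3, h4, h1, h2, hd k j i, hd j k i, hd i k j]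
  ring

theorem scal_eq_of_einstein (hg : IsMetricOn U g) {Λ : ℝ} {x : Pt n} (hx : x ∈ U)
    (hΛ : ricci g x = Λ • g x) : scal g x = Λ * n := by
  have h1 := Matrix.nonsing_inv_mul (g x) (hg.isUnit_det hx)
  have h2 : scal g x = Λ * ((g x)⁻¹ * g x).trace := by
    rw [scal, hΛ, Matrix.trace, Finset.mul_sum]
    refine Finset.sum_congr rfl fun i _ => ?_
    rw [Matrix.diag_apply, Matrix.mul_apply, Finset.mul_sum]
    refine Finset.sum_congr rfl fun j _ => ?_
    rw [Matrix.smul_apply, smul_eq_mul, ← (hg.2 x hx).1.apply i j]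
    ring
  rw [h2, h1, Matrix.trace_one, Fintype.card_fin]

/-- For constant `Λ` the Schouten tensor is a constant multiple of the metric, hence parallel. -/
theorem cotton_eq_zero_of_einstein (hU : IsOpen U) (hg : IsMetricOn U g) {Λ : ℝ}
    (hΛ : ∀ x ∈ U, ricci g x = Λ • g x) {x : Pt n} (hx : x ∈ U) (i j k : Fin n) :
    cotton g x i j k = 0 := by
  obtain ⟨c, hc⟩ : ∃ c : ℝ, ∀ y ∈ U, schouten g y = c • g y := by
    refine ⟨1 / ((n : ℝ) - 2) * (Λ - Λ * n / (2 * ((n : ℝ) - 1))), fun y hy => ?_⟩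
    rw [schouten, hΛ y hy, scal_eq_of_einstein hg hy (hΛ y hy), ← sub_smul, smul_smul]
  have h1 : ∀ k i j, nabla2 g (schouten g) x k i j = c * nabla2 g g x k i j := fun k i j => by
    have h2 : pd k (fun y => schouten g y i j) x = c * pd k (fun y => g y i j) x := by
      rw [← pd_const_mul k c (differentiableAt_of_contDiffOn hU (hg.1 i j) hx)]
      exact pd_congr hU k (fun y hy => by simp [hc y hy]) hx
    rw [nabla2, nabla2, h2, hc x hx, mul_sub, mul_sub, Finset.mul_sum, Finset.mul_sum]
    simp only [Matrix.smul_apply, smul_eq_mul, mul_left_comm]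
  rw [cotton, h1, h1, nabla2_metric hU hg hx, nabla2_metric hU hg hx, mul_zero, sub_zero]

end Einstein

/-! ### The obstruction tensor -/

section Obstruction

variable {n : ℕ} {U : Set (Pt n)} {g : Pt n → Mat n}

theorem obsTerm₁_eq_zero (hU : IsOpen U) (hB : ∀ x ∈ U, bach g x = 0) {x : Pt n} (hx : x ∈ U) :
    obsTerm₁ g x = 0 := by
  have h2 : ∀ y ∈ U, ∀ k i j, nabla2 g (bach g) y k i j = 0 := fun y hy k i j => by
    rw [nabla2, pd_eq_zero hU k (fun z hz => by rw [hB z hz, Matrix.zero_apply]) hy, hB y hy]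
    simp
  ext i j
  rw [obsTerm₁, Matrix.of_apply, Matrix.zero_apply]
  refine Finset.sum_eq_zero fun k _ => Finset.sum_eq_zero fun l _ => ?_
  rw [nabla3, pd_eq_zero hU l (fun z hz => h2 z hz k i j) hx]
  simp [h2 x hx]

theorem obsTerm₂_eq_zero {x : Pt n} (hB : bach g x = 0) : obsTerm₂ g x = 0 := by
  ext i j
  simp [obsTerm₂, raiseBoth, hB]

/-- The factor `B` alone suffices here; the vanishing of `tr P` is reserved for the seventh term. -/
theorem obsTerm₃_eq_zero {x : Pt n} (hB : bach g x = 0) : obsTerm₃ g x = 0 := by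
  ext i j
  simp [obsTerm₃, hB]

/-- The contraction vanishes before symmetrisation, so both halves of the symmetrised term do. -/
theorem obsTerm₄_eq_zero {x : Pt n} (h : ∀ i j, ∑ k, ∑ l, raiseBoth g (schouten g) x k l *
    nabla3 g (cotton g) x l i j k = 0) : obsTerm₄ g x = 0 := by
  ext i j
  rw [obsTerm₄, Matrix.of_apply, Matrix.zero_apply]
  have h1 : ∑ k, ∑ l, raiseBoth g (schouten g) x k l *
      ((1 / 2) * (nabla3 g (cotton g) x l i j k + nabla3 g (cotton g) x l j i k)) =
      (1 / 2) * (∑ k, ∑ l, raiseBoth g (schouten g) x k l * nabla3 g (cotton g) x l i j k +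
        ∑ k, ∑ l, raiseBoth g (schouten g) x k l * nabla3 g (cotton g) x l j i k) := by
    simp only [← Finset.sum_add_distrib, Finset.mul_sum]
    refine Finset.sum_congr rfl fun k _ => Finset.sum_congr rfl fun l _ => ?_
    ring
  rw [h1, h, h]
  ring

theorem obsTerm₇_eq_zero (hU : IsOpen U) (h : ∀ x ∈ U, trSchouten g x = 0) {x : Pt n}
    (hx : x ∈ U) : obsTerm₇ g x = 0 := by
  ext i j
  simp [obsTerm₇, pd_eq_zero hU _ h hx]

theorem obsTerm₈_eq_zero {x : Pt n} (h : ∀ k l, ∑ m, raiseFst g (schouten g) x k m *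
    raiseBoth g (schouten g) x m l = 0) : obsTerm₈ g x = 0 := by
  ext i j
  simp [obsTerm₈, mul_assoc, ← Finset.mul_sum, h]

end Obstruction

/-! ### The metric of `f` -/

section Bryant

variable {a : Fin 6} {U : Set (Pt 6)} {f : Pt 6 → ℝ}

section Base

variable (h : Admissible a U f) (hl : Table.levelCheck (a + 1) = true)
  (hb : Table.baseCheck (a + 1) = true)
include h hl hb

theorem isMetricOn_bryantMetric : IsMetricOn U (bryantMetric f) := by
  simp only [Table.baseCheck, Bool.and_eq_true] at hb
  exact isMetricOn_of_table (rep_metric h 1 0 (fun _ => 0) 1 hl)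
    (fun _ hx => mval_unit h _ one_ne_zero one_ne_zero hx) hb.2.1
    (isModel_base h 1 0 (fun _ => 0) 1)

theorem bryantMetric_tensors {x : Pt 6} (hx : x ∈ U) :
    bach (bryantMetric f) x = 0 ∧ schoutenSq (bryantMetric f) x = 0 ∧
      trSchouten (bryantMetric f) x = 0 ∧
      (∀ k l, ∑ m, raiseFst (bryantMetric f) (schouten (bryantMetric f)) x k m *
        raiseBoth (bryantMetric f) (schouten (bryantMetric f)) x m l = 0) ∧
      (∀ i j, ∑ k, ∑ l, raiseBoth (bryantMetric f) (schouten (bryantMetric f)) x k l *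
        nabla3 (bryantMetric f) (cotton (bryantMetric f)) x l i j k = 0) ∧
      obsTerm₅ (bryantMetric f) x = 0 ∧ obsTerm₆ (bryantMetric f) x = 0 := by
  simp only [Table.baseCheck, Bool.and_eq_true] at hb
  obtain ⟨hg, hi, hΓ, hP, hC, h1, h2, h3, h4, h5, h6, h7⟩ := hb
  have R := repMetric_base h 1 0 (fun _ => 0) 1 hl one_ne_zero one_ne_zero hi
  have hn : 2 < 6 := by norm_num
  refine ⟨?_, ?_, (R.trSchouten hg hΓ hn).eq_zero h3 hx, fun k l => ?_, fun i j => ?_, ?_, ?_⟩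
  · ext i j
    exact (R.bach hg hΓ hn hP hC i j).eq_zero (Table.of_zero2 h1 i j) hx
  · ext i j
    exact (R.schoutenSq hg hΓ hn i j).eq_zero (Table.of_zero2 h2 i j) hx
  · exact (R.schoutenSqUp hg hΓ hn k l).eq_zero (Table.of_zero2 h4 k l) hx
  · exact (R.schoutenNablaCotton hg hΓ hn hP hC i j).eq_zero (Table.of_zero2 h5 i j) hx
  · ext i j
    rw [obsTerm₅, Matrix.of_apply, (R.cottonSq₁ hg hΓ hn hP i j).eq_zero (Table.of_zero2 h6 i j) hx,
      mul_zero, Matrix.zero_apply]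
  · ext i j
    rw [obsTerm₆, Matrix.of_apply, (R.cottonSq₂ hg hΓ hn hP i j).eq_zero (Table.of_zero2 h7 i j) hx,
      mul_zero, Matrix.zero_apply]

theorem bryantMetric_bach_mu {x : Pt 6} (hx : x ∈ U) :
    bach (bryantMetric f) x = 0 ∧ schoutenSq (bryantMetric f) x = 0 ∧
      mu (bryantMetric f) x = 0 := by
  obtain ⟨h1, h2, -⟩ := bryantMetric_tensors h hl hb hx
  refine ⟨h1, h2, ?_⟩
  rw [mu, h1, h2, smul_zero, add_zero]

/-- The first three terms vanish with `B`, the fourth with `Pᵏˡ ∇ₗ Cᵢⱼₖ`, the seventh with `tr P`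
and the eighth with `P²`; the fifth and sixth are evaluated directly. The first and seventh contain
derivatives and need the vanishing on all of the open set `U`. -/
theorem bryantMetric_obstruction {x : Pt 6} (hx : x ∈ U) :
    obsTerm₁ (bryantMetric f) x = 0 ∧ obsTerm₂ (bryantMetric f) x = 0 ∧
      obsTerm₃ (bryantMetric f) x = 0 ∧ obsTerm₄ (bryantMetric f) x = 0 ∧
      obsTerm₅ (bryantMetric f) x = 0 ∧ obsTerm₆ (bryantMetric f) x = 0 ∧
      obsTerm₇ (bryantMetric f) x = 0 ∧ obsTerm₈ (bryantMetric f) x = 0 ∧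
      obstruction (bryantMetric f) x = 0 := by
  have h0 := fun y hy => bryantMetric_tensors h hl hb (x := y) hy
  obtain ⟨hB, -, -, hS, hN, h5, h6⟩ := h0 x hx
  have h1 := obsTerm₁_eq_zero h.1 (fun y hy => (h0 y hy).1) hx
  have h2 := obsTerm₂_eq_zero hB
  have h3 := obsTerm₃_eq_zero hB
  have h4 := obsTerm₄_eq_zero hN
  have h7 := obsTerm₇_eq_zero h.1 (fun y hy => (h0 y hy).2.2.1) hx
  have h8 := obsTerm₈_eq_zero hS
  refine ⟨h1, h2, h3, h4, h5, h6, h7, h8, ?_⟩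
  rw [obstruction, h1, h2, h3, h4, h5, h6, h7, h8]
  simp only [add_zero]

/-- The ambient metric is represented by its table. -/
theorem rep_ambientForm (ε : ℝ) (i j : Fin (6 + 2)) :
    Rep (ambientSpace U ε) (fun X => Var.env (ambientVal a f X))
      (fun X => ambientForm (fun x ϱ => bryantMetric f x + (2 * ϱ) • schouten (bryantMetric f) x)
        X i j) (Table.ambient (a + 1) i j) := by
  simp only [Table.baseCheck, Bool.and_eq_true] at hb
  obtain ⟨hg, hi, hΓ, -⟩ := hb
  set V := ambientSpace U ε
  set env := fun X => Var.env (ambientVal a f X)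
  -- At an ambient point `X`, the frozen constants of the base model are chosen as the values of `t`
  -- and `ϱ` at `X`; the assignments then agree, and the fractions of the base can be used
  -- unchanged.
  have hm : ∀ k l : Fin 6, Rep V env (fun X => bryantMetric f (basePt X) k l)
      (Table.metric (a + 1) k l) := fun k l X hX =>
    rep_metric h (X 0) (X (Fin.last 7)) (fun _ => 0) 1 hl k l (basePt X) hX.2.1
  have hP : ∀ k l : Fin 6, Rep V env (fun X => schouten (bryantMetric f) (basePt X) k l)
      (Table.baseSchouten (a + 1) k l) := fun k l X hX =>
    (repMetric_base h (X 0) (X (Fin.last 7)) (fun _ => 0) 1 hl hX.1.ne' one_ne_zero hi).schouten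
      hg hΓ (by norm_num) k l (basePt X) hX.2.1
  have ht : Rep V env (fun X => X 0) (Table.var (.coord 0)) :=
    rep_var (v := .coord 0) (by decide +kernel)
  have hϱ : Rep V env (fun X => X (Fin.last 7)) (Table.var (.coord 7)) :=
    rep_var (v := .coord 7) (by decide +kernel)
  have h2ϱ : Rep V env (fun X => 2 * X (Fin.last 7)) Table.twoRho :=
    ((Rep.int 2).mul hϱ).congr fun _ _ => by simp
  have hdx : ∀ i j : Fin (6 + 2), Rep V env (fun _ => dx i j) (Table.delta i j) :=
    fun i j => rep_dx i j
  have hα : ∀ k : Fin (6 + 2), Rep V env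
      (fun X => X (Fin.last 7) * dx 0 k + X 0 * dx (Fin.last 7) k) _ :=
    fun k => (hϱ.mul (hdx 0 k)).add (ht.mul (hdx (Fin.last 7) k))
  refine Rep.congr ((((hα i).mul (hdx 0 j)).add ((hdx 0 i).mul (hα j))).add
    ((ht.mul ht).mul (Rep.sum fun k : Fin 6 => Rep.sum fun l : Fin 6 =>
      (((hm k l).add (h2ϱ.mul (hP k l))).mul (hdx (baseIdx k) i)).mul (hdx (baseIdx l) j)))) ?_
  intro X _
  simp [ambientForm, symProd, pow_two]

theorem isAmbientMetric_ambientForm (ha : Table.ambientCheck (a + 1) = true) (ε : ℝ) :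
    IsAmbientMetric U (bryantMetric f) ε (ambientForm fun x ϱ =>
      bryantMetric f x + (2 * ϱ) • schouten (bryantMetric f) x) := by
  have hG := rep_ambientForm h hl hb ε
  have hM := isModel_ambient h ε
  simp only [Table.ambientCheck, Bool.and_eq_true] at ha
  obtain ⟨hg, hi, hΓ, hR⟩ := ha
  have hu : ∀ X ∈ ambientSpace U ε, mval (Var.env (ambientVal a f X)) Table.unit ≠ 0 :=
    fun X hX => mval_unit h _ hX.1.ne' one_ne_zero hX.2.1
  refine ⟨isMetricOn_of_table hG hu hi hM, ⟨_, fun X _ => rfl, fun x _ => by simp⟩,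
    fun X hX => ?_⟩
  have R := repMetric_of_table hM hG hu hi
  ext i j
  exact (R.ricci hg hΓ i j).eq_zero (Table.of_zero2 hR i j) hX

end Base

/-! ### Conformal changes -/

section Conformal

variable (h : Admissible a U f) (hl : Table.levelCheck (a + 1) = true)
  {φ : Pt 6 → ℝ} (hφ : ContDiffOn ℝ ∞ φ U)
  (hi : Table.inverse 6 (Table.conformal (a + 1)) (Table.conformalInv (a + 1)) Table.unit = true)
include h hl

theorem rep_rescale (i j : Fin 6) :
    Rep U
      (fun x => Var.env (varVal a f 1 0 (fun l => listPd φ l x) (Real.exp (2 * φ x)) x))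
      (fun x => rescale φ (bryantMetric f) x i j) (Table.conformal (a + 1) i j) := by
  have he : Rep U (fun x => Var.env (varVal a f 1 0 (fun l => listPd φ l x) (Real.exp (2 * φ x)) x))
      (fun x => Real.exp (2 * φ x)) (Table.var .expo) :=
    rep_var (v := .expo) (by decide +kernel)
  -- Representation is a pointwise statement, so the constants standing for `φ` may be taken as its
  -- actual values at `x`.
  exact fun x hx => (he x hx).mul (rep_metric h 1 0 _ _ hl i j x hx)

include hφ hi

theorem isMetricOn_rescale : IsMetricOn U (rescale φ (bryantMetric f)) :=
  isMetricOn_of_table (rep_rescale h hl)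
    (fun _ hx => mval_unit h _ one_ne_zero (Real.exp_ne_zero _) hx) hi (isModel_conformal h hφ)

theorem repMetric_rescale :
    RepMetric U
      (fun x => Var.env (varVal a f 1 0 (fun l => listPd φ l x) (Real.exp (2 * φ x)) x)) Var.top
      (fun i => Var.diffList true (a + 1) (i + 1)) (rescale φ (bryantMetric f))
      (Table.conformal (a + 1)) (Table.conformalInv (a + 1)) :=
  repMetric_of_table (isModel_conformal h hφ) (rep_rescale h hl)
    (fun _ hx => mval_unit h _ one_ne_zero (Real.exp_ne_zero _) hx) hi

end Conformal

/-! ### The obstruction to being conformally Cotton or Einstein -/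

section NotConformallyCotton

variable {i j k : Fin 6} {m : ℕ} {l : JetPoly} (h : Admissible a U f)
  (hl : Table.levelCheck (a + 1) = true)
  (hc : Table.conformalCheck (a + 1) i j k (Frac.mul (Table.cottonFactor m) l.toFrac) = true)
  (hv : l.isValid = true) {p : Pt 6} (hp : p ∈ U)
  (hΦ : MvPolynomial.eval (jet a f p) l.toMvPolynomial ≠ 0)
include h hl hc hv hp hΦ

theorem not_conformallyCotton : ¬ ConformallyCotton U (bryantMetric f) := by
  rintro ⟨φ, hφ, hC⟩
  simp only [Table.conformalCheck, Bool.and_eq_true] at hc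
  obtain ⟨hg, hi, hΓ, hj, hk, h0⟩ := hc
  have h1 := (repMetric_rescale h hl hφ hi).cotton_of_lev hg hΓ (by norm_num) i j k hj hk p hp
  beta_reduce at h1
  rw [hC p hp] at h1
  have h2 : Frac.Val (Var.env (varVal a f 1 0 (fun l => listPd φ l p) (Real.exp (2 * φ p)) p))
      (1 / (108 * pd 2 f p ^ m)) (Table.cottonFactor m) := by
    have e := Var.mval_code (varVal a f 1 0 (fun l => listPd φ l p) (Real.exp (2 * φ p)) p)
      (v := .jet 0 1) (by decide +kernel)
    have e2 : varVal a f 1 0 (fun l => listPd φ l p) (Real.exp (2 * φ p)) p (.jet 0 1) =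
      pd 2 f p := rfl
    have h3 := Frac.val_inv_mval (ρ := Var.env (varVal a f 1 0 (fun l => listPd φ l p)
      (Real.exp (2 * φ p)) p)) (c := 108) (m := Var.code (.jet 0 1) ^ m) (by norm_num)
      (by rw [mval_pow, e, e2]; exact pow_ne_zero _ (h.2.2.2 p hp))
    rw [mval_pow, e, e2, Nat.cast_ofNat] at h3
    exact h3
  -- The Cotton component is zero at `p` by assumption and equals `Φ / (108 f₃ᵐ)` by the table, so
  -- `Φ` would vanish at `p`.
  have h3 := (h1.sub (h2.mul (JetPoly.val_toFrac (J := jet a f p) (fun _ => rfl) l hv))).eq_zero h0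
  rw [zero_sub, neg_eq_zero] at h3
  refine mul_ne_zero (one_div_ne_zero (mul_ne_zero (by norm_num) (pow_ne_zero _ ?_))) hΦ h3
  exact h.2.2.2 p hp

theorem not_conformallyEinstein : ¬ ConformallyEinstein U (bryantMetric f) := by
  rintro ⟨φ, hφ, Λ, hΛ⟩
  refine not_conformallyCotton h hl hc hv hp hΦ ⟨φ, hφ, fun x hx i j k => ?_⟩
  simp only [Table.conformalCheck, Bool.and_eq_true] at hc
  exact cotton_eq_zero_of_einstein h.1 (isMetricOn_rescale h hl hφ hc.2.1) hΛ hx i j k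

end NotConformallyCotton

end Bryant

theorem cottonPoly₁_ne_zero : cottonPoly₁.toMvPolynomial ≠ 0 := by
  intro h
  -- At this point only the first term survives, with value `20`.
  have h1 := congrArg (MvPolynomial.eval fun m : ℕ × ℕ =>
    if m = (0, 2) ∨ m = (0, 3) ∨ m = (1, 1) then (1 : ℝ) else 0) h
  simp [cottonPoly₁, JetPoly.toMvPolynomial] at h1

theorem cottonPoly₂_ne_zero : cottonPoly₂.toMvPolynomial ≠ 0 := by
  intro h
  have h1 := congrArg (MvPolynomial.eval fun m : ℕ × ℕ =>
    -- Again only the first term survives, with value `20`: each of the others contains a variable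
    -- that is set to zero.
    if m = (0, 2) ∨ m = (1, 1) then (1 : ℝ) else 0) h
  simp [cottonPoly₂, JetPoly.toMvPolynomial] at h1

end BryantConf

/-! ### The theorem for both types of `f` -/

theorem mainTheorem10 (a : Fin 6) (ha : a = 0 ∨ a = 1) :
    (∃ Φ : MvPolynomial (ℕ × ℕ) ℝ, Φ ≠ 0 ∧
      ∀ (U : Set (BryantConf.Pt 6)) (f : BryantConf.Pt 6 → ℝ), BryantConf.Admissible a U f →
        ∀ p ∈ U, MvPolynomial.eval (BryantConf.jet a f p) Φ ≠ 0 →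
          ∀ V : Set (BryantConf.Pt 6), IsOpen V → p ∈ V → V ⊆ U →
            ¬ BryantConf.ConformallyCotton V (BryantConf.bryantMetric f) ∧
            ¬ BryantConf.ConformallyEinstein V (BryantConf.bryantMetric f)) ∧
    (∀ (U : Set (BryantConf.Pt 6)) (f : BryantConf.Pt 6 → ℝ), BryantConf.Admissible a U f →
      BryantConf.IsMetricOn U (BryantConf.bryantMetric f) ∧
      (∀ x ∈ U,
        BryantConf.bach (BryantConf.bryantMetric f) x = 0 ∧
        BryantConf.schoutenSq (BryantConf.bryantMetric f) x = 0 ∧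
        BryantConf.mu (BryantConf.bryantMetric f) x = 0) ∧
      (∀ x ∈ U,
        BryantConf.obsTerm₁ (BryantConf.bryantMetric f) x = 0 ∧
        BryantConf.obsTerm₂ (BryantConf.bryantMetric f) x = 0 ∧
        BryantConf.obsTerm₃ (BryantConf.bryantMetric f) x = 0 ∧
        BryantConf.obsTerm₄ (BryantConf.bryantMetric f) x = 0 ∧
        BryantConf.obsTerm₅ (BryantConf.bryantMetric f) x = 0 ∧
        BryantConf.obsTerm₆ (BryantConf.bryantMetric f) x = 0 ∧
        BryantConf.obsTerm₇ (BryantConf.bryantMetric f) x = 0 ∧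
        BryantConf.obsTerm₈ (BryantConf.bryantMetric f) x = 0 ∧
        BryantConf.obstruction (BryantConf.bryantMetric f) x = 0) ∧
      (∀ ε : ℝ, 0 < ε →
        BryantConf.IsAmbientMetric U (BryantConf.bryantMetric f) ε
          (BryantConf.ambientForm fun x ϱ =>
            BryantConf.bryantMetric f x +
              (2 * ϱ) • BryantConf.schouten (BryantConf.bryantMetric f) x))) := by
  obtain ⟨hl, hb, hA⟩ : BryantConf.Table.levelCheck (a + 1) = true ∧
      BryantConf.Table.baseCheck (a + 1) = true ∧ BryantConf.Table.ambientCheck (a + 1) = true := by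
    rcases ha with rfl | rfl
    · exact ⟨BryantConf.Table.level_one, BryantConf.Table.base_one, BryantConf.Table.ambient_one⟩
    · exact ⟨BryantConf.Table.level_two, BryantConf.Table.base_two, BryantConf.Table.ambient_two⟩
  obtain ⟨i, j, k, m, l, hc, hv, h0⟩ : ∃ (i j k : Fin 6) (m : ℕ) (l : BryantConf.JetPoly),
      BryantConf.Table.conformalCheck (a + 1) i j k
        (BryantConf.Frac.mul (BryantConf.Table.cottonFactor m) l.toFrac) = true ∧
      l.isValid = true ∧ l.toMvPolynomial ≠ 0 := by
    rcases ha with rfl | rfl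
    · exact ⟨4, 4, 2, 6, BryantConf.cottonPoly₁, BryantConf.Table.conformal_one,
        by decide +kernel, BryantConf.cottonPoly₁_ne_zero⟩
    · exact ⟨3, 3, 2, 5, BryantConf.cottonPoly₂, BryantConf.Table.conformal_two,
        by decide +kernel, BryantConf.cottonPoly₂_ne_zero⟩
  refine ⟨⟨l.toMvPolynomial, h0, fun U f h p hp hΦ V hV hpV hVU => ?_⟩, fun U f h =>
    ⟨BryantConf.isMetricOn_bryantMetric h hl hb,
      fun x hx => BryantConf.bryantMetric_bach_mu h hl hb hx,
      fun x hx => BryantConf.bryantMetric_obstruction h hl hb hx,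
      fun ε _ => BryantConf.isAmbientMetric_ambientForm h hl hb hA ε⟩⟩
  -- Admissibility passes to the neighbourhood `V`, so the pointwise obstruction at `p` applies with
  -- `V` in place of `U`.
  have hm := h.mono hV hVU
  exact ⟨BryantConf.not_conformallyCotton hm hl hc hv hpV hΦ,
    BryantConf.not_conformallyEinstein hm hl hc hv hpV hΦ⟩
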